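/- Let $N\ge 3$ and let $\Omega\subset\mathbb{R}^2$ be an open (convex) regular polygon with $N$ sides, of arbitrary centre, size and orientation. Let $P(\Omega)=\mathcal{H}^1(\partial\Omega)$ be its perimeter and $$\mu_1(\Omega)=\inf\left\{\frac{\int_\Omega|\nabla u|^2\,dx}{\int_\Omega u^2\,dx} \;:\; u\in H^1(\Omega),\ u\neq 0,\ \int_\Omega u\,dx=0\right\}$$ its first nontrivial Neumann eigenvalue. Then $$P(\Omega)^2\,\mu_1(\Omega)\le 16\pi^2,$$ and equality holds if $N=3$ or $N=4$. -/

import Mathlib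

open MeasureTheory
open scoped ContDiff

noncomputable section

namespace NeumannPolygon

/-- The Euclidean plane `ℝ²`. -/
abbrev Plane : Type := EuclideanSpace ℝ (Fin 2)

/-- The `k`-th of the `N` points equally spaced on the circle with centre `c` and radius `r`,
starting at the angle `α`. -/
def vertex (N : ℕ) (c : Plane) (r α : ℝ) (k : Fin N) : Plane :=
  c + r • !₂[Real.cos (α + 2 * Real.pi * (k : ℕ) / N), Real.sin (α + 2 * Real.pi * (k : ℕ) / N)]

/-- `Ω` is an open (convex) regular polygon with `N ≥ 3` sides, of arbitrary centre, size and
orientation: its vertices are `N` equally spaced points of a circle of positive radius. -/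
def IsRegularPolygon (N : ℕ) (Ω : Set Plane) : Prop :=
  3 ≤ N ∧ ∃ (c : Plane) (r α : ℝ), 0 < r ∧
    Ω = interior (convexHull ℝ (Set.range (vertex N c r α)))

/-- The perimeter of a planar domain: the length (one-dimensional Hausdorff measure) of its
boundary. -/
def perimeter (Ω : Set Plane) : ℝ :=
  (Measure.hausdorffMeasure 1 (frontier Ω) : ENNReal).toReal

/-- `G` is a weak (distributional) gradient of `u` in the open set `Ω`: for every test function
`φ ∈ C_c^∞(Ω)` and every direction `v`, `∫_Ω u ∂_v φ = - ∫_Ω (G · v) φ`. -/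
def IsWeakGradient (Ω : Set Plane) (u : Plane → ℝ) (G : Plane → Plane) : Prop :=
  ∀ φ : Plane → ℝ, ContDiff ℝ ∞ φ → HasCompactSupport φ → tsupport φ ⊆ Ω → ∀ v : Plane,
    (∫ x in Ω, u x * fderiv ℝ φ x v) = -(∫ x in Ω, inner ℝ (G x) v * φ x)

/-- `u` belongs to the Sobolev space `H¹(Ω)` and `G` is its weak gradient. -/
structure IsH1With (Ω : Set Plane) (u : Plane → ℝ) (G : Plane → Plane) : Prop where
  memLp : MemLp u 2 (volume.restrict Ω)
  memLp_grad : MemLp G 2 (volume.restrict Ω)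
  isWeakGradient : IsWeakGradient Ω u G

/-- The values of the Rayleigh quotient `∫_Ω |∇u|² / ∫_Ω u²` at the nonzero `u ∈ H¹(Ω)` with mean
value zero. -/
def rayleighQuotients (Ω : Set Plane) : Set ℝ :=
  {q | ∃ (u : Plane → ℝ) (G : Plane → Plane), IsH1With Ω u G ∧
    (∫ x in Ω, u x) = 0 ∧ 0 < (∫ x in Ω, u x ^ 2) ∧
    q = (∫ x in Ω, ‖G x‖ ^ 2) / (∫ x in Ω, u x ^ 2)}

/-- The first nontrivial Neumann eigenvalue of `Ω`, through its variational definition. -/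
def neumannMu1 (Ω : Set Plane) : ℝ := sInf (rayleighQuotients Ω)

end NeumannPolygon

end

open MeasureTheory
open scoped ContDiff

namespace NeumannPolygon


/-! For `N = 3` and `N = 4` the eigenvalue is computed exactly; for `N ≥ 5` it is bounded by a trial
function, with room to spare, since the disc has `P²μ₁ ≈ 13.6 π²`.

Exact values. Square and equilateral triangle are fundamental domains of reflection groups, so
finite sums of plane waves invariant under the reflections in the sides are Neumann eigenfunctions
(`isNeumannEigenpair_wave`). The normal component of their gradient is odd under each reflection,
hence bounded by a multiple of the distance to the side; this lets cutoffs replace boundary traces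
in the integration by parts (`IsH1With.integral_mul_div`). The spectral theorem is not needed to see
that the smallest explicit eigenvalue `μ` is optimal. For `v` in the span of the eigenfunctions,
solving `-ΔU = v` termwise (up to constants) and applying Cauchy–Schwarz gives `μ (∫ u v)² ≤ ∫ |∇u|²
∫ v²` for every `u` of mean zero. The span is an algebra separating the points of the closure, so
Stone–Weierstrass makes it dense in `L²`, and `v = u` is the Poincaré inequality
(`poincare_of_eigenfunctions`).

Upper bound. For `N ≥ 5`, with inradius `h` and `y = x - c`, the two functions `(1 - κ|y|²) yᵢ` have
mean zero by rotational symmetry. Adding their Rayleigh inequalities leaves only radial moments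
(`neumannMu1_mul_moment_le`), which are polynomials in `t = tan (π/N)` times powers of `h`. As `P =
2 N h t`, the claim becomes `μ₁ h² ≤ 4 (π/(N t))²`. Bounding `π/N = arctan t` below by a Taylor
polynomial turns it into a one-variable polynomial inequality in `t²` (`five_le_polynomial_bound`).
-/

/-! ### Smooth functions as elements of `H¹` -/

/-- A continuous function is square integrable over a bounded set. -/
theorem memLp_restrict_of_continuous {E : Type*} [NormedAddCommGroup E]
    [SecondCountableTopology E]
    {Ω : Set Plane} (hb : Bornology.IsBounded Ω) {f : Plane → E} (hf : Continuous f)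
    (p : ENNReal) : MemLp f p (volume.restrict Ω) := by
  obtain ⟨C, hC⟩ := hb.isCompact_closure.exists_bound_of_continuousOn hf.continuousOn
  have : IsFiniteMeasure (volume.restrict Ω) := ⟨by simpa using hb.measure_lt_top⟩
  have h : ∀ᵐ x ∂(volume.restrict (closure Ω)), ‖f x‖ ≤ C :=
    (ae_restrict_iff' isClosed_closure.measurableSet).2 (Filter.Eventually.of_forall hC)
  exact MemLp.of_bound hf.aestronglyMeasurable C
    (ae_mono (Measure.restrict_mono subset_closure le_rfl) h)

theorem isFiniteMeasure_restrict {Ω : Set Plane} (hb : Bornology.IsBounded Ω) :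
    IsFiniteMeasure (volume.restrict Ω) := ⟨by simpa using hb.measure_lt_top⟩

theorem integrable_restrict_of_continuous {E : Type*} [NormedAddCommGroup E]
    [SecondCountableTopology E]
    {Ω : Set Plane} (hb : Bornology.IsBounded Ω) {f : Plane → E} (hf : Continuous f) :
    Integrable f (volume.restrict Ω) :=
  memLp_one_iff_integrable.1 (memLp_restrict_of_continuous hb hf 1)

theorem integrable_inner_of_memLp {μ : Measure Plane} {F G : Plane → Plane} (hF : MemLp F 2 μ)
    (hG : MemLp G 2 μ) : Integrable (fun x => inner ℝ (F x) (G x)) μ := by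
  refine (hF.norm.integrable_mul hG.norm).mono'
    (hF.aestronglyMeasurable.inner hG.aestronglyMeasurable)
    (Filter.Eventually.of_forall fun x => norm_inner_le_norm _ _)

/-- A smooth function on the plane belongs to `H¹` of any bounded set. -/
theorem isH1With_of_contDiff {Ω : Set Plane} (hb : Bornology.IsBounded Ω)
    {u : Plane → ℝ} {G : Plane → Plane} (hu : ContDiff ℝ ∞ u) (hG : Continuous G)
    (hGu : ∀ x v, fderiv ℝ u x v = inner ℝ (G x) v) : IsH1With Ω u G := by
  refine ⟨memLp_restrict_of_continuous hb hu.continuous 2,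
    memLp_restrict_of_continuous hb hG 2, ?_⟩
  intro φ hφ hc hs v
  have hd : Continuous fun x => fderiv ℝ φ x v :=
    (hφ.continuous_fderiv (by simp)).clm_apply continuous_const
  have hdu : Continuous fun x => fderiv ℝ u x v :=
    (hu.continuous_fderiv (by simp)).clm_apply continuous_const
  have hz : ∀ x ∉ Ω, φ x = 0 := fun x hx => image_eq_zero_of_notMem_tsupport fun h => hx (hs h)
  have hz' : ∀ x ∉ Ω, fderiv ℝ φ x v = 0 := fun x hx => by
    rw [fderiv_of_notMem_tsupport ℝ fun h => hx (hs h)]; rfl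
  have hcd : HasCompactSupport fun x => fderiv ℝ φ x v := hc.fderiv_apply (𝕜 := ℝ) v
  -- The test function vanishes off `Ω`, so both integrals extend to the whole plane, where
  -- integration by parts has no boundary term.
  rw [setIntegral_eq_integral_of_forall_compl_eq_zero fun x hx => by rw [hz' x hx, mul_zero],
    setIntegral_eq_integral_of_forall_compl_eq_zero fun x hx => by rw [hz x hx, mul_zero]]
  simp_rw [← hGu]
  refine integral_mul_fderiv_eq_neg_fderiv_mul_of_integrable ?_ ?_ ?_ ?_ ?_
  · exact (hdu.mul hφ.continuous).integrable_of_hasCompactSupport hc.mul_left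
  · exact (hu.continuous.mul hd).integrable_of_hasCompactSupport hcd.mul_left
  · exact (hu.continuous.mul hφ.continuous).integrable_of_hasCompactSupport hc.mul_left
  · exact fun x _ => (hu.differentiable (by simp)).differentiableAt
  · exact fun x _ => (hφ.differentiable (by simp)).differentiableAt

/-! ### Cutoffs and integration by parts on polygons -/

/-- The bound on `s |η' s|` is invariant under scaling: every `s ↦ η (m s)` with `m > 0` satisfies
it with the same `C`. Thus the cutoffs built from `η` have derivative at most `C / distance`,
uniformly in `m`. -/
theorem exists_smooth_step : ∃ (η : ℝ → ℝ) (C : ℝ), ContDiff ℝ ∞ η ∧ (∀ s ≤ 1, η s = 0) ∧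
    (∀ s, 2 ≤ s → η s = 1) ∧ (∀ s, 0 ≤ η s ∧ η s ≤ 1) ∧ (∀ s, 2 < s → deriv η s = 0) ∧
    0 ≤ C ∧ ∀ s, 0 < s → s * |deriv η s| ≤ C := by
  have hsm : ContDiff ℝ ∞ fun s : ℝ => Real.smoothTransition (s - 1) :=
    Real.smoothTransition.contDiff.comp (contDiff_id.sub contDiff_const)
  have hd := hsm.continuous_deriv (by simp)
  have h0 : ∀ s : ℝ, 2 < s → deriv (fun s : ℝ => Real.smoothTransition (s - 1)) s = 0 := by
    intro s hs
    have : (fun s : ℝ => Real.smoothTransition (s - 1)) =ᶠ[nhds s] fun _ => 1 := by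
      filter_upwards [lt_mem_nhds hs] with y hy
      exact Real.smoothTransition.one_of_one_le (by linarith)
    rw [this.deriv_eq]; simp
  obtain ⟨C, hC⟩ := (isCompact_Icc (a := (0 : ℝ)) (b := 2)).exists_bound_of_continuousOn
    (f := fun s => s * deriv (fun s : ℝ => Real.smoothTransition (s - 1)) s)
    (continuous_id.mul hd).continuousOn
  have hC0 : 0 ≤ C := (norm_nonneg _).trans (hC 0 (by simp))
  refine ⟨_, C, hsm, fun s hs => Real.smoothTransition.zero_of_nonpos (by linarith),
    fun s hs => Real.smoothTransition.one_of_one_le (by linarith),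
    fun s => ⟨Real.smoothTransition.nonneg _, Real.smoothTransition.le_one _⟩, h0, hC0, ?_⟩
  intro s hs
  by_cases h2 : 2 < s
  · rw [h0 s h2]; simpa using hC0
  · have := hC s ⟨hs.le, not_lt.1 h2⟩
    rwa [Real.norm_eq_abs, abs_mul, abs_of_pos hs] at this

/-- The signed distance to the `k`-th of a family of lines. -/
noncomputable def gap {K : Type*} (n : K → Plane) (b : K → ℝ) (k : K) (x : Plane) : ℝ :=
  b k - inner ℝ (n k) x

/-- The intersection of a family of open half planes. -/
def openPolygon {K : Type*} (n : K → Plane) (b : K → ℝ) : Set Plane := {x | ∀ k, 0 < gap n b k x}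

theorem contDiff_gap {K : Type*} (n : K → Plane) (b : K → ℝ) (k : K) :
    ContDiff ℝ ∞ (gap n b k) :=
  contDiff_const.sub (contDiff_const.inner ℝ contDiff_id)

theorem hasFDerivAt_gap {K : Type*} (n : K → Plane) (b : K → ℝ) (k : K) (x : Plane) :
    HasFDerivAt (gap n b k) (-(innerSL ℝ (n k))) x :=
  ((innerSL ℝ (n k)).hasFDerivAt).const_sub _

theorem isOpen_openPolygon {K : Type*} [Finite K] (n : K → Plane) (b : K → ℝ) :
    IsOpen (openPolygon n b) := by
  simp only [openPolygon, Set.ofPred_forall]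
  exact isOpen_iInter_of_finite fun k =>
    isOpen_lt continuous_const (contDiff_gap n b k).continuous

/-- Smooth cutoffs exhausting a bounded polygon, whose derivative is bounded along directions
that become tangential at the sides. -/
theorem exists_cutoff {K : Type*} [Fintype K] (n : K → Plane) (b : K → ℝ)
    (hb : Bornology.IsBounded (openPolygon n b)) :
    ∃ (χ : ℕ → Plane → ℝ) (D : ℝ), (∀ m, ContDiff ℝ ∞ (χ m)) ∧
      (∀ m, HasCompactSupport (χ m)) ∧ (∀ m, tsupport (χ m) ⊆ openPolygon n b) ∧
      (∀ m x, |χ m x| ≤ 1) ∧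
      (∀ x ∈ openPolygon n b, ∀ᶠ m in Filter.atTop, χ m x = 1 ∧ fderiv ℝ (χ m) x = 0) ∧
      (∀ m, ∀ x ∈ openPolygon n b, ∀ (w : Plane) (M : ℝ),
        (∀ k, |inner ℝ (n k) w| ≤ M * gap n b k x) → |fderiv ℝ (χ m) x w| ≤ D * M) := by
  classical
  obtain ⟨η, C, hη, hη0, hη1, hη01, hη', hC, hηC⟩ := exists_smooth_step
  have hcont : ∀ m : ℕ, ContDiff ℝ ∞ fun x => ∏ k, η (gap n b k x * (m + 1)) := fun m =>
    contDiff_prod fun k _ => hη.comp ((contDiff_gap n b k).mul contDiff_const)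
  have hder : ∀ (m : ℕ) (x : Plane), HasFDerivAt (fun x => ∏ k, η (gap n b k x * (m + 1)))
      (∑ k, (∏ j ∈ Finset.univ.erase k, η (gap n b j x * (m + 1))) •
        (deriv η (gap n b k x * (m + 1)) • ((m + 1 : ℝ) • -(innerSL ℝ (n k))))) x := by
    intro m x
    refine HasFDerivAt.finsetProd fun k _ => ?_
    have h1 : HasDerivAt η (deriv η (gap n b k x * (m + 1))) (gap n b k x * (m + 1)) :=
      ((hη.differentiable (by simp)).differentiableAt).hasDerivAt
    exact h1.comp_hasFDerivAt x ((hasFDerivAt_gap n b k x).mul_const (m + 1 : ℝ))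
  have hts : ∀ m : ℕ, tsupport (fun x => ∏ k, η (gap n b k x * (m + 1))) ⊆ openPolygon n b := by
    intro m
    have hcl : IsClosed {x | ∀ k, 1 ≤ gap n b k x * (m + 1)} := by
      simp only [Set.ofPred_forall]
      exact isClosed_iInter fun k =>
        isClosed_le continuous_const ((contDiff_gap n b k).continuous.mul continuous_const)
    -- The product vanishes as soon as one scaled gap is below `1`, so its support lies in a closed
    -- set strictly inside all the half planes.
    refine (closure_minimal (t := {x | ∀ k, 1 ≤ gap n b k x * (m + 1)}) ?_ hcl).trans ?_
    · intro x hx k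
      by_contra hk
      exact hx (Finset.prod_eq_zero (Finset.mem_univ k) (hη0 _ (not_le.1 hk).le))
    · intro x hx k
      have := hx k
      by_contra hk
      have : gap n b k x * (m + 1) ≤ 0 :=
        mul_nonpos_of_nonpos_of_nonneg (not_lt.1 hk) (by positivity)
      linarith
  refine ⟨fun m x => ∏ k, η (gap n b k x * (m + 1)), Fintype.card K * C, hcont, ?_, hts, ?_, ?_,
    ?_⟩
  · exact fun m => hb.isCompact_closure.of_isClosed_subset (isClosed_tsupport _)
      ((hts m).trans subset_closure)
  · intro m x
    rw [Finset.abs_prod]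
    exact Finset.prod_le_one (fun _ _ => abs_nonneg _)
      fun k _ => by rw [abs_of_nonneg (hη01 _).1]; exact (hη01 _).2
  · intro x hx
    have h1 : ∀ᶠ m : ℕ in Filter.atTop, ∀ k, 2 < gap n b k x * (m + 1) := by
      rw [Filter.eventually_all]
      intro k
      obtain ⟨M, hM⟩ := exists_nat_gt (2 / gap n b k x)
      filter_upwards [Filter.eventually_ge_atTop M] with m hm
      have : (M : ℝ) ≤ m := by exact_mod_cast hm
      have h3 := (div_lt_iff₀ (hx k)).1 hM
      nlinarith [hx k]
    filter_upwards [h1] with m hm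
    refine ⟨Finset.prod_eq_one fun k _ => hη1 _ (hm k).le, ?_⟩
    rw [(hder m x).fderiv]
    refine Finset.sum_eq_zero fun k _ => ?_
    rw [hη' _ (hm k)]; simp
  · intro m x hx w M hw
    rw [(hder m x).fderiv]
    simp only [FunLike.coe_sum, Finset.sum_apply, FunLike.coe_smul, Pi.smul_apply, smul_eq_mul,
      FunLike.coe_neg, Pi.neg_apply, innerSL_apply_apply]
    refine (Finset.abs_sum_le_sum_abs _ _).trans ?_
    have : ∀ k ∈ (Finset.univ : Finset K), |(∏ j ∈ Finset.univ.erase k, η (gap n b j x * (m + 1))) *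
        (deriv η (gap n b k x * (m + 1)) * ((m + 1 : ℝ) * -inner ℝ (n k) w))| ≤ C * M := by
      intro k _
      have hg := hx k
      have hM : 0 ≤ M := by
        by_contra hM
        have h0 := hw k
        have := abs_nonneg (inner ℝ (n k) w)
        nlinarith
      have hp : |∏ j ∈ Finset.univ.erase k, η (gap n b j x * (m + 1))| ≤ 1 := by
        rw [Finset.abs_prod]
        exact Finset.prod_le_one (fun _ _ => abs_nonneg _)
          fun k _ => by rw [abs_of_nonneg (hη01 _).1]; exact (hη01 _).2
      have hs : 0 < gap n b k x * (m + 1) := by positivity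
      have h2 := hηC _ hs
      rw [abs_mul]
      refine (mul_le_of_le_one_left (abs_nonneg _) hp).trans ?_
      rw [abs_mul, abs_mul, abs_neg, abs_of_pos (by positivity : (0 : ℝ) < m + 1)]
      -- The factor `gap` supplied by the hypothesis on `w` absorbs the factor `m + 1` produced by
      -- the scaling.
      calc _ ≤ |deriv η (gap n b k x * (m + 1))| * ((m + 1) * (M * gap n b k x)) := by
            gcongr; exact hw k
        _ = (gap n b k x * (m + 1) * |deriv η (gap n b k x * (m + 1))|) * M := by ring
        _ ≤ C * M := by gcongr
    refine (Finset.sum_le_sum this).trans_eq ?_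
    rw [Finset.sum_const, Finset.card_univ, nsmul_eq_mul, mul_assoc]

/-- Integration by parts on a polygon for a smooth vector field which is tangential at the
boundary. -/
theorem IsH1With.integral_mul_div {K : Type*} [Fintype K] {n : K → Plane} {b : K → ℝ}
    (hb : Bornology.IsBounded (openPolygon n b)) {J : Type*} [Fintype J] {f : J → Plane → ℝ}
    (hf : ∀ j, ContDiff ℝ ∞ (f j)) (a : J → Plane) (M : ℝ)
    (hM : ∀ k, ∀ x ∈ openPolygon n b, |∑ j, f j x * inner ℝ (n k) (a j)| ≤ M * gap n b k x)
    {u : Plane → ℝ} {G : Plane → Plane} (hu : IsH1With (openPolygon n b) u G) :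
    ∫ x in openPolygon n b, u x * ∑ j, fderiv ℝ (f j) x (a j) =
      -∫ x in openPolygon n b, inner ℝ (G x) (∑ j, f j x • a j) := by
  set Ω := openPolygon n b with hΩ
  have hm : MeasurableSet Ω := (isOpen_openPolygon n b).measurableSet
  have := isFiniteMeasure_restrict hb
  obtain ⟨χ, D, hχ, hχc, hχs, hχ1, hχe, hχD⟩ := exists_cutoff n b hb
  have hui : Integrable u (volume.restrict Ω) := hu.memLp.integrable one_le_two
  have hGi : Integrable G (volume.restrict Ω) := hu.memLp_grad.integrable one_le_two
  have hdf : ∀ j, Continuous fun x => fderiv ℝ (f j) x (a j) := fun j =>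
    ((hf j).continuous_fderiv (by simp)).clm_apply continuous_const
  have hdiv : Continuous fun x => ∑ j, fderiv ℝ (f j) x (a j) :=
    continuous_finsetSum _ fun j _ => hdf j
  have hF : Continuous fun x => ∑ j, f j x • a j :=
    continuous_finsetSum _ fun j _ => (hf j).continuous.smul continuous_const
  obtain ⟨C₁, hC₁⟩ := hb.isCompact_closure.exists_bound_of_continuousOn hdiv.continuousOn
  obtain ⟨C₂, hC₂⟩ := hb.isCompact_closure.exists_bound_of_continuousOn hF.continuousOn
  have hw : ∀ k, ∀ x ∈ Ω, |inner ℝ (n k) (∑ j, f j x • a j)| ≤ M * gap n b k x := by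
    intro k x hx
    simp only [inner_sum, inner_smul_right]
    exact hM k x hx
  have hprod : ∀ m j x, fderiv ℝ (fun x => χ m x * f j x) x (a j) =
      χ m x * fderiv ℝ (f j) x (a j) + fderiv ℝ (χ m) x (f j x • a j) := by
    intro m j x
    rw [fderiv_fun_mul ((hχ m).differentiable (by simp)).differentiableAt
      ((hf j).differentiable (by simp)).differentiableAt]
    simp
  have hint : ∀ {g : Plane → ℝ}, Continuous g →
      Integrable (fun x => u x * g x) (volume.restrict Ω) := fun hg =>
    (memLp_restrict_of_continuous hb hg 2).integrable_mul hu.memLp |>.congr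
      (Filter.Eventually.of_forall fun x => mul_comm _ _)
  have hintG : ∀ {g : Plane → Plane}, Continuous g →
      Integrable (fun x => inner ℝ (G x) (g x)) (volume.restrict Ω) := fun hg =>
    integrable_inner_of_memLp hu.memLp_grad (memLp_restrict_of_continuous hb hg 2)
  -- The weak gradient tested against `χ m * f j` in the direction `a j`, summed over `j`; the
  -- derivative of the cutoff only enters along the field.
  have key : ∀ m, ∫ x in Ω, u x * (χ m x * (∑ j, fderiv ℝ (f j) x (a j)) +
      fderiv ℝ (χ m) x (∑ j, f j x • a j)) =
      -∫ x in Ω, χ m x * inner ℝ (G x) (∑ j, f j x • a j) := by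
    intro m
    have hsm : ∀ j, ContDiff ℝ ∞ fun x => χ m x * f j x := fun j => (hχ m).mul (hf j)
    have e : ∀ j, ∫ x in Ω, u x * fderiv ℝ (fun x => χ m x * f j x) x (a j) =
        -∫ x in Ω, inner ℝ (G x) (a j) * (χ m x * f j x) := fun j =>
      hu.isWeakGradient _ (hsm j) ((hχc m).mul_right)
        ((tsupport_mul_subset_left).trans (hχs m)) (a j)
    have e2 := Finset.sum_congr rfl fun j (_ : j ∈ Finset.univ) => e j
    rw [← integral_finsetSum, Finset.sum_neg_distrib, ← integral_finsetSum] at e2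
    · refine Eq.trans (integral_congr_ae (Filter.Eventually.of_forall fun x => ?_)) (e2.trans
        (congrArg Neg.neg (integral_congr_ae (Filter.Eventually.of_forall fun x => ?_))))
      · simp only [map_sum]
        rw [Finset.mul_sum, ← Finset.sum_add_distrib, Finset.mul_sum]
        exact Finset.sum_congr rfl fun j _ => by rw [hprod]
      · simp only [inner_sum]
        rw [Finset.mul_sum]
        exact Finset.sum_congr rfl fun j _ => by rw [inner_smul_right]; ring
    · intro j _
      have := hintG (g := fun x => (χ m x * f j x) • a j)
        ((hsm j).continuous.smul continuous_const)
      refine this.congr (Filter.Eventually.of_forall fun x => ?_)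
      simp only [inner_smul_right]; ring
    · intro j _
      exact hint (((hsm j).continuous_fderiv (by simp)).clm_apply continuous_const)
  have hχcont := fun m => (hχ m).continuous
  have hdχ : ∀ m, Continuous fun x => fderiv ℝ (χ m) x (∑ j, f j x • a j) := fun m =>
    ((hχ m).continuous_fderiv (by simp)).clm_apply hF
  -- Dominated convergence: the cutoff term is bounded by `D * M` because the field is tangential at
  -- the sides, and at each point it is eventually zero.
  have lim1 : Filter.Tendsto (fun m => ∫ x in Ω, u x * (χ m x * (∑ j, fderiv ℝ (f j) x (a j)) +
      fderiv ℝ (χ m) x (∑ j, f j x • a j))) Filter.atTop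
      (nhds (∫ x in Ω, u x * ∑ j, fderiv ℝ (f j) x (a j))) := by
    refine tendsto_integral_of_dominated_convergence (fun x => ‖u x‖ * (C₁ + D * M)) ?_
      (hui.norm.mul_const _) ?_ ?_
    · exact fun m => (hint (((hχcont m).mul hdiv).add (hdχ m))).aestronglyMeasurable
    · intro m
      refine (ae_restrict_iff' hm).2 (Filter.Eventually.of_forall fun x hx => ?_)
      rw [norm_mul]
      gcongr
      refine (norm_add_le _ _).trans (add_le_add ?_ (hχD m x hx _ M fun k => hw k x hx))
      rw [norm_mul]
      exact (mul_le_of_le_one_left (norm_nonneg _) (hχ1 m x)).trans (hC₁ x (subset_closure hx))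
    · refine (ae_restrict_iff' hm).2 (Filter.Eventually.of_forall fun x hx => ?_)
      refine tendsto_const_nhds.congr' ?_
      filter_upwards [hχe x hx] with m hm
      rw [hm.1, hm.2]; simp
  have lim2 : Filter.Tendsto (fun m => -∫ x in Ω, χ m x * inner ℝ (G x) (∑ j, f j x • a j))
      Filter.atTop (nhds (-∫ x in Ω, inner ℝ (G x) (∑ j, f j x • a j))) := by
    refine (tendsto_integral_of_dominated_convergence (fun x => ‖G x‖ * C₂) ?_
      (hGi.norm.mul_const _) ?_ ?_).neg
    · exact fun m => (hχcont m).aestronglyMeasurable.mul (hintG hF).aestronglyMeasurable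
    · intro m
      refine (ae_restrict_iff' hm).2 (Filter.Eventually.of_forall fun x hx => ?_)
      rw [norm_mul]
      refine (mul_le_of_le_one_left (norm_nonneg _) (hχ1 m x)).trans
        ((norm_inner_le_norm _ _).trans ?_)
      gcongr
      exact hC₂ x (subset_closure hx)
    · refine (ae_restrict_iff' hm).2 (Filter.Eventually.of_forall fun x hx => ?_)
      refine tendsto_const_nhds.congr' ?_
      filter_upwards [hχe x hx] with m hm
      rw [hm.1, one_mul]
  simp_rw [key] at lim1
  exact tendsto_nhds_unique lim1 lim2


/-! ### Neumann eigenfunctions from reflection invariance -/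

/-- `φ`, with gradient `F`, is an eigenfunction of the Neumann Laplacian of `Ω` in the weak sense,
for the eigenvalue `lam`. -/
structure IsNeumannEigenpair (Ω : Set Plane) (φ : Plane → ℝ) (F : Plane → Plane) (lam : ℝ) :
    Prop where
  continuous : Continuous φ
  isH1 : IsH1With Ω φ F
  integral_inner : ∀ (u : Plane → ℝ) (G : Plane → Plane), IsH1With Ω u G →
    ∫ x in Ω, inner ℝ (G x) (F x) = lam * ∫ x in Ω, u x * φ x

/-- A finite sum of plane waves of the same frequency which is invariant under the reflections in
the sides of a polygon is an eigenfunction of the Neumann Laplacian. -/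
theorem isNeumannEigenpair_wave {K : Type*} [Fintype K] {n : K → Plane} {b : K → ℝ}
    (hb : Bornology.IsBounded (openPolygon n b)) (hn : ∀ k, ‖n k‖ = 1)
    {J : Type*} [Fintype J] (c δ : J → ℝ) (A : J → Plane) (lam : ℝ) (hA : ∀ j, ‖A j‖ ^ 2 = lam)
    {φ : Plane → ℝ} (hφ : ∀ x, φ x = ∑ j, c j * Real.cos (inner ℝ (A j) x + δ j))
    (hR : ∀ k x, φ (x + (2 * gap n b k x) • n k) = φ x) :
    IsNeumannEigenpair (openPolygon n b) φ
      (fun x => ∑ j, (-(c j * Real.sin (inner ℝ (A j) x + δ j))) • A j) lam := by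
  obtain rfl : φ = fun x => ∑ j, c j * Real.cos (inner ℝ (A j) x + δ j) := funext hφ
  have hth : ∀ j, ContDiff ℝ ∞ fun x : Plane => inner ℝ (A j) x + δ j := fun j =>
    (contDiff_const.inner ℝ contDiff_id).add contDiff_const
  have hdth : ∀ j (x : Plane), HasFDerivAt (fun x : Plane => inner ℝ (A j) x + δ j)
      (innerSL ℝ (A j)) x := fun j x => ((innerSL ℝ (A j)).hasFDerivAt).add_const _
  have hsin : ∀ j, ContDiff ℝ ∞ fun x : Plane => -(c j * Real.sin (inner ℝ (A j) x + δ j)) :=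
    fun j => (contDiff_const.mul (hth j).sin).neg
  have hcos : ContDiff ℝ ∞ fun x : Plane => ∑ j, c j * Real.cos (inner ℝ (A j) x + δ j) :=
    ContDiff.sum fun j _ => contDiff_const.mul (hth j).cos
  have hF : Continuous fun x : Plane =>
      ∑ j, (-(c j * Real.sin (inner ℝ (A j) x + δ j))) • A j :=
    continuous_finsetSum _ fun j _ => (hsin j).continuous.smul continuous_const
  have hder : ∀ x : Plane, HasFDerivAt (fun x : Plane => ∑ j, c j * Real.cos (inner ℝ (A j) x + δ j))
      (∑ j, c j • (-Real.sin (inner ℝ (A j) x + δ j)) • innerSL ℝ (A j)) x := fun x =>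
    HasFDerivAt.fun_sum fun j _ => ((hdth j x).cos).const_mul (c j)
  have hgrad : ∀ x v : Plane, (∑ j, c j • (-Real.sin (inner ℝ (A j) x + δ j)) • innerSL ℝ (A j)) v =
      inner ℝ (∑ j, (-(c j * Real.sin (inner ℝ (A j) x + δ j))) • A j) v := by
    intro x v
    simp only [FunLike.coe_sum, Finset.sum_apply, FunLike.coe_smul, Pi.smul_apply, smul_eq_mul,
      innerSL_apply_apply, sum_inner, real_inner_smul_left]
    exact Finset.sum_congr rfl fun j _ => by ring
  refine ⟨hcos.continuous, isH1With_of_contDiff hb hcos hF fun x v => ?_, ?_⟩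
  · rw [(hder x).fderiv, hgrad]
  intro u G hu
  have hdsin : ∀ j (x : Plane),
      fderiv ℝ (fun x : Plane => -(c j * Real.sin (inner ℝ (A j) x + δ j))) x (A j) =
        -lam * (c j * Real.cos (inner ℝ (A j) x + δ j)) := by
    intro j x
    rw [(((hdth j x).sin).const_mul (c j)).fun_neg.fderiv]
    simp only [FunLike.coe_neg, Pi.neg_apply, FunLike.coe_smul, Pi.smul_apply, smul_eq_mul,
      innerSL_apply_apply, real_inner_self_eq_norm_sq, hA]
    ring
  -- Differentiating the invariance `φ ∘ R = φ` along `n k`, which the reflection `R` reverses,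
  -- makes the normal derivative odd.
  have hodd : ∀ k (x : Plane), inner ℝ (n k) (∑ j, (-(c j * Real.sin (inner ℝ (A j)
      (x + (2 * gap n b k x) • n k) + δ j))) • A j) =
      -inner ℝ (n k) (∑ j, (-(c j * Real.sin (inner ℝ (A j) x + δ j))) • A j) := by
    intro k x
    have h1 : HasFDerivAt (fun x => x + (2 * gap n b k x) • n k)
        (ContinuousLinearMap.id ℝ Plane +
          ((2 : ℝ) • -(innerSL ℝ (n k))).smulRight (n k)) x :=
      (hasFDerivAt_id x).add (((hasFDerivAt_gap n b k x).const_mul 2).smul_const (n k))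
    have h2 := (hder (x + (2 * gap n b k x) • n k)).comp x h1
    have h3 := h2.unique ((hder x).congr_of_eventuallyEq
      (Filter.Eventually.of_forall fun y => hR k y))
    have h4 := DFunLike.congr_fun h3 (n k)
    have h5 : (ContinuousLinearMap.id ℝ Plane +
          ((2 : ℝ) • -(innerSL ℝ (n k))).smulRight (n k)) (n k) = -n k := by
      simp only [FunLike.coe_add, Pi.add_apply, ContinuousLinearMap.id_apply,
        ContinuousLinearMap.smulRight_apply, FunLike.coe_smul, Pi.smul_apply, FunLike.coe_neg,
        Pi.neg_apply, innerSL_apply_apply, real_inner_self_eq_norm_sq, hn, smul_eq_mul]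
      module
    rw [ContinuousLinearMap.comp_apply, hgrad, hgrad, h5, inner_neg_right] at h4
    rw [real_inner_comm, real_inner_comm _ (n k)]
    linarith
  -- By oddness, twice the normal component is its difference between `x` and the mirror image, at
  -- distance twice the gap; `sin` is 1-Lipschitz and `|⟨n k, A j⟩|² ≤ lam`.
  have hM : ∀ k, ∀ x ∈ openPolygon n b,
      |∑ j, -(c j * Real.sin (inner ℝ (A j) x + δ j)) * inner ℝ (n k) (A j)| ≤
        (∑ j, |c j| * lam) * gap n b k x := by
    intro k x hx
    have e : ∀ y : Plane, ∑ j, -(c j * Real.sin (inner ℝ (A j) y + δ j)) * inner ℝ (n k) (A j) =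
        inner ℝ (n k) (∑ j, (-(c j * Real.sin (inner ℝ (A j) y + δ j))) • A j) := fun y => by
      simp only [inner_sum, inner_smul_right]
    have h2 : 2 * ∑ j, -(c j * Real.sin (inner ℝ (A j) x + δ j)) * inner ℝ (n k) (A j) =
        ∑ j, c j * inner ℝ (n k) (A j) * (Real.sin (inner ℝ (A j)
          (x + (2 * gap n b k x) • n k) + δ j) - Real.sin (inner ℝ (A j) x + δ j)) := by
      have := hodd k x
      rw [← e, ← e] at this
      have h3 : ∑ j, c j * inner ℝ (n k) (A j) * (Real.sin (inner ℝ (A j)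
          (x + (2 * gap n b k x) • n k) + δ j) - Real.sin (inner ℝ (A j) x + δ j)) =
          ∑ j, -(c j * Real.sin (inner ℝ (A j) x + δ j)) * inner ℝ (n k) (A j) -
          ∑ j, -(c j * Real.sin (inner ℝ (A j) (x + (2 * gap n b k x) • n k) + δ j)) *
            inner ℝ (n k) (A j) := by
        rw [← Finset.sum_sub_distrib]
        exact Finset.sum_congr rfl fun j _ => by ring
      rw [h3, this]; ring
    have h4 : |2 * ∑ j, -(c j * Real.sin (inner ℝ (A j) x + δ j)) * inner ℝ (n k) (A j)| ≤
        2 * ((∑ j, |c j| * lam) * gap n b k x) := by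
      rw [h2, Finset.sum_mul, Finset.mul_sum]
      refine (Finset.abs_sum_le_sum_abs _ _).trans (Finset.sum_le_sum fun j _ => ?_)
      have hg := hx k
      have h5 : |Real.sin (inner ℝ (A j) (x + (2 * gap n b k x) • n k) + δ j) -
          Real.sin (inner ℝ (A j) x + δ j)| ≤ 2 * gap n b k x * |inner ℝ (n k) (A j)| := by
        refine (Real.abs_sin_sub_sin_le _ _).trans_eq ?_
        rw [inner_add_right, real_inner_smul_right, real_inner_comm]
        rw [show inner ℝ x (A j) + 2 * gap n b k x * inner ℝ (A j) (n k) + δ j -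
          (inner ℝ x (A j) + δ j) = 2 * gap n b k x * inner ℝ (A j) (n k) by ring, abs_mul,
          abs_of_pos (by positivity), real_inner_comm]
      have h6 : |inner ℝ (n k) (A j)| ^ 2 ≤ lam := by
        rw [← hA j]
        gcongr
        simpa [hn] using abs_real_inner_le_norm (n k) (A j)
      rw [abs_mul, abs_mul]
      calc _ ≤ |c j| * |inner ℝ (n k) (A j)| * (2 * gap n b k x * |inner ℝ (n k) (A j)|) := by
            gcongr
        _ = 2 * (|c j| * |inner ℝ (n k) (A j)| ^ 2 * gap n b k x) := by ring
        _ ≤ _ := by gcongr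
    rw [abs_mul, abs_two] at h4
    linarith
  have := hu.integral_mul_div hb hsin A _ hM
  simp only [hdsin, ← Finset.mul_sum] at this
  rw [← neg_inj, ← this, ← neg_mul, ← integral_const_mul]
  exact integral_congr_ae (Filter.Eventually.of_forall fun x => by ring)


/-! ### The Poincaré inequality from explicit eigenfunctions -/

theorem integrable_mul_of_memLp {μ : Measure Plane} {f g : Plane → ℝ} (hf : MemLp f 2 μ)
    (hg : MemLp g 2 μ) : Integrable (fun x => f x * g x) μ := hf.integrable_mul hg

/-- Cauchy–Schwarz, from the discriminant of the nonnegative quadratic `t ↦ ∫ ‖F - t G‖²`. -/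
theorem sq_integral_inner_le {μ : Measure Plane} {F G : Plane → Plane} (hF : MemLp F 2 μ)
    (hG : MemLp G 2 μ) :
    (∫ x, inner ℝ (F x) (G x) ∂μ) ^ 2 ≤ (∫ x, ‖F x‖ ^ 2 ∂μ) * ∫ x, ‖G x‖ ^ 2 ∂μ := by
  have hFF := hF.integrable_norm_pow (by simp)
  have hGG := hG.integrable_norm_pow (by simp)
  have hFG := integrable_inner_of_memLp hF hG
  simp only at hFF hGG
  have h : ∀ t : ℝ, 0 ≤ (∫ x, ‖G x‖ ^ 2 ∂μ) * (t * t) +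
      (-2 * ∫ x, inner ℝ (F x) (G x) ∂μ) * t + ∫ x, ‖F x‖ ^ 2 ∂μ := by
    intro t
    have h1 : 0 ≤ ∫ x, ‖F x - t • G x‖ ^ 2 ∂μ := integral_nonneg fun x => by positivity
    have h2 : (fun x => ‖F x - t • G x‖ ^ 2) = fun x =>
        (t * t) * ‖G x‖ ^ 2 + (-2 * t) * inner ℝ (F x) (G x) + ‖F x‖ ^ 2 := by
      funext x
      rw [norm_sub_sq_real, inner_smul_right, norm_smul, mul_pow, Real.norm_eq_abs, sq_abs]
      ring
    have i1 : Integrable (fun x => t * t * ‖G x‖ ^ 2) μ := hGG.const_mul _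
    have i2 : Integrable (fun x => -2 * t * inner ℝ (F x) (G x)) μ := hFG.const_mul _
    have i3 : Integrable (fun x => t * t * ‖G x‖ ^ 2 + -2 * t * inner ℝ (F x) (G x)) μ := i1.add i2
    rw [h2, integral_add i3 hFF, integral_add i1 i2, integral_const_mul,
      integral_const_mul] at h1
    linarith
  have := discrim_le_zero h
  rw [discrim] at this
  nlinarith

section Poincare

variable {Ω : Set Plane}

theorem IsNeumannEigenpair.memLp {φ : Plane → ℝ} {F : Plane → Plane} {lam : ℝ}
    (h : IsNeumannEigenpair Ω φ F lam) : MemLp φ 2 (volume.restrict Ω) := h.isH1.memLp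

/-- Eigenfunctions for different eigenvalues are orthogonal. -/
theorem IsNeumannEigenpair.integral_mul_eq_zero {φ ψ : Plane → ℝ} {F H : Plane → Plane}
    {lam lam' : ℝ} (h : IsNeumannEigenpair Ω φ F lam) (h' : IsNeumannEigenpair Ω ψ H lam')
    (hne : lam ≠ lam') : ∫ x in Ω, φ x * ψ x = 0 := by
  have h1 := h.integral_inner _ _ h'.isH1
  have h2 := h'.integral_inner _ _ h.isH1
  have e1 : ∀ x, inner ℝ (H x) (F x) = inner ℝ (F x) (H x) := fun x => real_inner_comm _ _
  have e2 : ∀ x, ψ x * φ x = φ x * ψ x := fun x => mul_comm _ _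
  simp_rw [e1, e2] at h1
  have h3 : (lam - lam') * ∫ x in Ω, φ x * ψ x = 0 := by rw [sub_mul, ← h1, h2]; simp
  exact (mul_eq_zero.1 h3).resolve_left (sub_ne_zero.2 hne)

/-- The Poincaré inequality in dual form, tested with combinations of eigenfunctions. -/
theorem dual_poincare_sum {μ : ℝ} (hμ : 0 < μ) {m : ℕ} (c : Fin m → ℝ)
    {φ : Fin m → Plane → ℝ} {F : Fin m → Plane → Plane} {lam : Fin m → ℝ}
    (h : ∀ i, IsNeumannEigenpair Ω (φ i) (F i) (lam i))
    (hlam : ∀ i, (lam i = 0 ∧ ∃ a, ∀ x ∈ Ω, φ i x = a) ∨ μ ≤ lam i) (hm : MeasurableSet Ω)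
    {u : Plane → ℝ} {G : Plane → Plane} (hu : IsH1With Ω u G) (hu0 : ∫ x in Ω, u x = 0) :
    μ * (∫ x in Ω, u x * ∑ i, c i * φ i x) ^ 2 ≤
      (∫ x in Ω, ‖G x‖ ^ 2) * ∫ x in Ω, (∑ i, c i * φ i x) ^ 2 := by
  set g : Fin m → Fin m → ℝ := fun i j => ∫ x in Ω, φ i x * φ j x with hg
  have hg0 : ∀ i j, lam i ≠ lam j → g i j = 0 := fun i j hij =>
    (h i).integral_mul_eq_zero (h j) hij
  have hquad : ∀ d : Fin m → ℝ, ∫ x in Ω, (∑ i, d i * φ i x) ^ 2 =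
      ∑ i, ∑ j, d i * d j * g i j := by
    intro d
    have : ∀ x, (∑ i, d i * φ i x) ^ 2 = ∑ i, ∑ j, d i * d j * (φ i x * φ j x) := fun x => by
      rw [sq, Finset.sum_mul_sum]
      exact Finset.sum_congr rfl fun i _ => Finset.sum_congr rfl fun j _ => by ring
    simp_rw [this]
    rw [integral_finsetSum _ fun i _ => integrable_finsetSum _ fun j _ =>
      (integrable_mul_of_memLp (h i).memLp (h j).memLp).const_mul _]
    refine Finset.sum_congr rfl fun i _ => ?_
    rw [integral_finsetSum _ fun j _ =>
      (integrable_mul_of_memLp (h i).memLp (h j).memLp).const_mul _]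
    exact Finset.sum_congr rfl fun j _ => integral_const_mul _ _
  -- The gradient of the termwise solution of `-ΔU = v`. The convention `0⁻¹ = 0` discards the
  -- constant eigenfunctions, which pair to zero with `u` anyway.
  set Ψ : Plane → Plane := fun x => ∑ i, (c i * (lam i)⁻¹) • F i x with hΨ
  have hΨm : MemLp Ψ 2 (volume.restrict Ω) :=
    memLp_finsetSum _ fun i _ => (h i).isH1.memLp_grad.const_smul (c i * (lam i)⁻¹)
  have hGΨ : ∀ (v : Plane → ℝ) (H : Plane → Plane), IsH1With Ω v H →
      ∫ x in Ω, inner ℝ (H x) (Ψ x) =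
        ∑ i, c i * (lam i)⁻¹ * (lam i * ∫ x in Ω, v x * φ i x) := by
    intro v H hv
    simp only [hΨ, inner_sum, inner_smul_right]
    rw [integral_finsetSum _ fun i _ =>
      (integrable_inner_of_memLp hv.memLp_grad (h i).isH1.memLp_grad).const_mul _]
    exact Finset.sum_congr rfl fun i _ => by rw [integral_const_mul, (h i).integral_inner _ _ hv]
  have h1 : ∫ x in Ω, inner ℝ (G x) (Ψ x) = ∫ x in Ω, u x * ∑ i, c i * φ i x := by
    rw [hGΨ u G hu]
    simp_rw [Finset.mul_sum]
    rw [integral_finsetSum _ fun i _ =>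
      integrable_mul_of_memLp hu.memLp ((h i).memLp.const_mul (c i))]
    refine Finset.sum_congr rfl fun i _ => ?_
    simp_rw [mul_left_comm (u _) (c i)]
    rw [integral_const_mul]
    rcases hlam i with ⟨h0, a, ha⟩ | h0
    · have : ∫ x in Ω, u x * φ i x = 0 := by
        rw [setIntegral_congr_fun hm fun x hx => by rw [ha x hx], integral_mul_const, hu0, zero_mul]
      rw [this]; simp
    · have : lam i ≠ 0 := (hμ.trans_le h0).ne'
      field_simp
  have h2 : ∫ x in Ω, ‖Ψ x‖ ^ 2 = ∑ i, ∑ j, c i * c j * (lam i)⁻¹ * g i j := by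
    simp_rw [← real_inner_self_eq_norm_sq]
    have e : ∀ x, inner ℝ (Ψ x) (Ψ x) = ∑ i, (c i * (lam i)⁻¹) * inner ℝ (F i x) (Ψ x) := fun x => by
      have : Ψ x = ∑ i, (c i * (lam i)⁻¹) • F i x := rfl
      nth_rewrite 1 [this]
      simp only [sum_inner, real_inner_smul_left]
    simp_rw [e]
    rw [integral_finsetSum _ fun i _ =>
      (integrable_inner_of_memLp (h i).isH1.memLp_grad hΨm).const_mul _]
    refine Finset.sum_congr rfl fun i _ => ?_
    rw [integral_const_mul, hGΨ _ _ (h i).isH1, Finset.mul_sum]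
    refine Finset.sum_congr rfl fun j _ => ?_
    by_cases hij : lam i = lam j
    · by_cases h0 : lam j = 0
      · rw [hij, h0]; simp
      · field_simp; rfl
    · have : ∫ x in Ω, φ i x * φ j x = 0 := hg0 i j hij
      rw [this, hg0 i j hij]; simp
  have h3 : μ * ∫ x in Ω, ‖Ψ x‖ ^ 2 ≤ ∫ x in Ω, (∑ i, c i * φ i x) ^ 2 := by
    -- By orthogonality of distinct eigenvalues, this square integral is exactly `∫ v² - μ ∫ ‖Ψ‖²`.
    -- The weight under the root is nonnegative since `lam i ≥ μ`, and equals `1` when `lam i = 0`.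
    have hs : 0 ≤ ∫ x in Ω, (∑ i, c i * √(1 - μ * (lam i)⁻¹) * φ i x) ^ 2 :=
      integral_nonneg fun x => sq_nonneg _
    rw [hquad fun i => c i * √(1 - μ * (lam i)⁻¹)] at hs
    rw [hquad, h2, ← sub_nonneg]
    refine hs.trans_eq ?_
    rw [Finset.mul_sum, ← Finset.sum_sub_distrib]
    refine Finset.sum_congr rfl fun i _ => ?_
    rw [Finset.mul_sum, ← Finset.sum_sub_distrib]
    refine Finset.sum_congr rfl fun j _ => ?_
    by_cases hij : lam i = lam j
    · have : 0 ≤ 1 - μ * (lam j)⁻¹ := by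
        rcases hlam j with ⟨h0, _⟩ | h0
        · rw [h0]; simp
        · have h5 : 0 < lam j := hμ.trans_le h0
          rw [sub_nonneg, ← div_eq_mul_inv]
          exact (div_le_one h5).2 h0
      have h6 := Real.mul_self_sqrt this
      rw [hij]
      linear_combination (c i * c j * g i j) * h6
    · rw [hg0 i j hij]; simp
  have h4 := sq_integral_inner_le hu.memLp_grad hΨm
  rw [h1] at h4
  have h5 : 0 ≤ ∫ x in Ω, ‖G x‖ ^ 2 := integral_nonneg fun x => by positivity
  calc μ * (∫ x in Ω, u x * ∑ i, c i * φ i x) ^ 2 ≤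
      μ * ((∫ x in Ω, ‖G x‖ ^ 2) * ∫ x in Ω, ‖Ψ x‖ ^ 2) := by gcongr
    _ = (∫ x in Ω, ‖G x‖ ^ 2) * (μ * ∫ x in Ω, ‖Ψ x‖ ^ 2) := by ring
    _ ≤ _ := by gcongr

/-- The Poincaré inequality with constant `μ` on a set with sufficiently many explicit
eigenfunctions: the nonconstant ones belong to eigenvalues at least `μ`, products of two are
combinations of others, and they separate points. -/
theorem poincare_of_eigenfunctions (hb : Bornology.IsBounded Ω) (hm : MeasurableSet Ω)
    {μ : ℝ} (hμ : 0 < μ) (E : Set C(Plane, ℝ))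
    (hE : ∀ φ ∈ E, ∃ F lam, IsNeumannEigenpair Ω φ F lam ∧
      ((lam = 0 ∧ ∃ a, ∀ x ∈ Ω, φ x = a) ∨ μ ≤ lam))
    (hone : 1 ∈ Submodule.span ℝ E)
    (hmul : ∀ φ ∈ E, ∀ ψ ∈ E, φ * ψ ∈ Submodule.span ℝ E)
    (hsep : ∀ x ∈ closure Ω, ∀ y ∈ closure Ω, x ≠ y → ∃ φ ∈ E, φ x ≠ φ y)
    {u : Plane → ℝ} {G : Plane → Plane} (hu : IsH1With Ω u G) (hu0 : ∫ x in Ω, u x = 0) :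
    μ * ∫ x in Ω, u x ^ 2 ≤ ∫ x in Ω, ‖G x‖ ^ 2 := by
  have := isFiniteMeasure_restrict hb
  have hui : Integrable u (volume.restrict Ω) := hu.memLp.integrable one_le_two
  set X := ∫ x in Ω, ‖G x‖ ^ 2 with hX
  have hX0 : 0 ≤ X := integral_nonneg fun x => by positivity
  have hspan : ∀ v ∈ Submodule.span ℝ E,
      μ * (∫ x in Ω, u x * v x) ^ 2 ≤ X * ∫ x in Ω, v x ^ 2 := by
    intro v hv
    obtain ⟨m, c, w, rfl⟩ := Submodule.mem_span_set'.1 hv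
    choose F lam hF hlam using fun i => hE _ (w i).2
    have := dual_poincare_sum hμ c (fun i => hF i) (fun i => hlam i) hm hu hu0
    simpa using this
  have hmul' : ∀ v w : C(Plane, ℝ), v ∈ Submodule.span ℝ E → w ∈ Submodule.span ℝ E →
      v * w ∈ Submodule.span ℝ E := by
    intro v w hv hw
    have : Submodule.span ℝ E * Submodule.span ℝ E ≤ Submodule.span ℝ E := by
      rw [Submodule.span_mul_span, Submodule.span_le]
      rintro _ ⟨φ, hφ, ψ, hψ, rfl⟩
      exact hmul φ hφ ψ hψ
    exact this (Submodule.mul_mem_mul hv hw)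
  -- Closure under products makes the span a subalgebra, to which Stone–Weierstrass applies on the
  -- compact closure of `Ω`.
  set A : Subalgebra ℝ C(Plane, ℝ) := (Submodule.span ℝ E).toSubalgebra hone hmul' with hA
  have hK : CompactSpace (closure Ω) := isCompact_iff_compactSpace.1 hb.isCompact_closure
  set R : C(Plane, ℝ) →ₐ[ℝ] C(closure Ω, ℝ) :=
    ContinuousMap.compRightAlgHom ℝ ℝ ⟨Subtype.val, continuous_subtype_val⟩ with hR
  have hsepA : (A.map R).SeparatesPoints := by
    intro x y hxy
    obtain ⟨φ, hφ, hne⟩ := hsep x x.2 y y.2 fun h => hxy (Subtype.ext h)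
    exact ⟨R φ, ⟨R φ, ⟨φ, Submodule.subset_span hφ, rfl⟩, rfl⟩, hne⟩
  have happrox : ∀ g : Plane → ℝ, Continuous g → ∀ ε : ℝ, 0 < ε →
      ∃ v ∈ Submodule.span ℝ E, ∀ x ∈ closure Ω, |v x - g x| < ε := by
    intro g hg ε hε
    obtain ⟨⟨_, v, hv, rfl⟩, hvg⟩ :=
      ContinuousMap.exists_mem_subalgebra_near_continuous_of_separatesPoints (A.map R) hsepA
        (fun x : closure Ω => g x) (hg.comp continuous_subtype_val) ε hε
    exact ⟨v, hv, fun x hx => hvg ⟨x, hx⟩⟩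
  have hcont : ∀ g : Plane → ℝ, Continuous g →
      μ * (∫ x in Ω, u x * g x) ^ 2 ≤ X * ∫ x in Ω, g x ^ 2 := by
    intro g hg
    have hpos : ∀ m : ℕ, (0 : ℝ) < 1 / (m + 1) := fun m => Nat.one_div_pos_of_nat
    choose v hv hvg using fun m : ℕ => happrox g hg (1 / (m + 1)) (hpos m)
    obtain ⟨C, hC⟩ := hb.isCompact_closure.exists_bound_of_continuousOn hg.continuousOn
    have hbd : ∀ m, ∀ x ∈ Ω, |v m x| ≤ C + 1 := by
      intro m x hx
      have h1 := hvg m x (subset_closure hx)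
      have h2 : |g x| ≤ C := hC x (subset_closure hx)
      have h3 : (1 : ℝ) / (m + 1) ≤ 1 := by
        rw [div_le_one (by positivity)]; linarith [(Nat.cast_nonneg m : (0 : ℝ) ≤ m)]
      have h4 : |v m x| ≤ |v m x - g x| + |g x| := by
        simpa using abs_add_le (v m x - g x) (g x)
      linarith
    have hlim : ∀ x ∈ Ω, Filter.Tendsto (fun m => v m x) Filter.atTop (nhds (g x)) := by
      intro x hx
      rw [tendsto_iff_dist_tendsto_zero]
      exact squeeze_zero (fun _ => dist_nonneg) (fun m => (hvg m x (subset_closure hx)).le)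
        tendsto_one_div_add_atTop_nhds_zero_nat
    have l1 : Filter.Tendsto (fun m => ∫ x in Ω, u x * v m x) Filter.atTop
        (nhds (∫ x in Ω, u x * g x)) := by
      refine tendsto_integral_of_dominated_convergence (fun x => ‖u x‖ * (C + 1)) ?_
        (hui.norm.mul_const _) ?_ ?_
      · exact fun m => hui.aestronglyMeasurable.mul (v m).continuous.aestronglyMeasurable
      · intro m
        refine (ae_restrict_iff' hm).2 (Filter.Eventually.of_forall fun x hx => ?_)
        rw [norm_mul]
        gcongr
        exact hbd m x hx
      · exact (ae_restrict_iff' hm).2 (Filter.Eventually.of_forall fun x hx =>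
          (hlim x hx).const_mul _)
    have l2 : Filter.Tendsto (fun m => ∫ x in Ω, v m x ^ 2) Filter.atTop
        (nhds (∫ x in Ω, g x ^ 2)) := by
      refine tendsto_integral_of_dominated_convergence (fun _ => (C + 1) ^ 2) ?_
        (integrable_const _) ?_ ?_
      · exact fun m => ((v m).continuous.pow 2).aestronglyMeasurable
      · intro m
        refine (ae_restrict_iff' hm).2 (Filter.Eventually.of_forall fun x hx => ?_)
        rw [norm_pow]
        exact pow_le_pow_left₀ (norm_nonneg _) (hbd m x hx) 2
      · exact (ae_restrict_iff' hm).2 (Filter.Eventually.of_forall fun x hx =>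
          (hlim x hx).pow 2)
    exact le_of_tendsto_of_tendsto' ((l1.pow 2).const_mul μ) (l2.const_mul X)
      fun m => hspan _ (hv m)
  -- Bounded continuous functions are dense in `L²` and both sides are continuous there, so the dual
  -- inequality reaches `f = u`.
  have hLp : ∀ f : Lp ℝ 2 (volume.restrict Ω),
      μ * (inner ℝ hu.memLp.toLp f) ^ 2 ≤ X * ‖f‖ ^ 2 := by
    have hd := BoundedContinuousFunction.toLp_denseRange ℝ (volume.restrict Ω) (p := 2) ℝ
      (by simp)
    intro f
    refine hd.induction_on f ?_ ?_
    · exact isClosed_le (by fun_prop) (by fun_prop)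
    · intro g
      have e := BoundedContinuousFunction.coeFn_toLp (p := 2) (volume.restrict Ω) ℝ g
      have h1 := hcont g g.continuous
      have e1 : inner ℝ hu.memLp.toLp (BoundedContinuousFunction.toLp 2 (volume.restrict Ω) ℝ g) =
          ∫ x in Ω, u x * g x := by
        rw [L2.inner_def]
        refine integral_congr_ae ?_
        filter_upwards [e, hu.memLp.coeFn_toLp] with x hx hx'
        rw [hx, hx']; simp [mul_comm]
      have e2 : ‖BoundedContinuousFunction.toLp 2 (volume.restrict Ω) ℝ g‖ ^ 2 =
          ∫ x in Ω, g x ^ 2 := by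
        rw [← real_inner_self_eq_norm_sq, L2.inner_def]
        refine integral_congr_ae ?_
        filter_upwards [e] with x hx
        rw [hx]; simp [sq]
      rwa [e1, e2]
  have h1 := hLp hu.memLp.toLp
  have h2 : ‖hu.memLp.toLp‖ ^ 2 = ∫ x in Ω, u x ^ 2 := by
    rw [← real_inner_self_eq_norm_sq, L2.inner_def]
    refine integral_congr_ae ?_
    filter_upwards [hu.memLp.coeFn_toLp] with x hx
    rw [hx]; simp [sq]
  rw [real_inner_self_eq_norm_sq, h2] at h1
  rcases (integral_nonneg fun x => sq_nonneg (u x) : 0 ≤ ∫ x in Ω, u x ^ 2).eq_or_lt with h0 | h0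
  · rw [← h0]; simpa using hX0
  · refine le_of_mul_le_mul_right ?_ h0
    linarith

end Poincare


/-! ### Geometry of the regular polygon -/

/-- The unit vector at angle `θ`. -/
noncomputable def dir (θ : ℝ) : Plane := !₂[Real.cos θ, Real.sin θ]

theorem inner_dir (a b : ℝ) : inner ℝ (dir a) (dir b) = Real.cos (a - b) := by
  simp [dir, PiLp.inner_apply, Fin.sum_univ_two, Real.cos_sub]; ring

theorem norm_dir (a : ℝ) : ‖dir a‖ = 1 := by
  have h := inner_dir a a
  rw [real_inner_self_eq_norm_sq, sub_self, Real.cos_zero] at h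
  nlinarith [norm_nonneg (dir a)]

theorem dir_periodic (a : ℝ) (m : ℤ) : dir (a + m * (2 * Real.pi)) = dir a := by
  rw [dir, dir, Real.cos_add_int_mul_two_pi, Real.sin_add_int_mul_two_pi]

theorem exists_eq_smul_dir (y : Plane) : ∃ (ρ φ : ℝ), 0 ≤ ρ ∧ y = ρ • dir φ := by
  refine ⟨‖(⟨y 0, y 1⟩ : ℂ)‖, Complex.arg ⟨y 0, y 1⟩, norm_nonneg _, ?_⟩
  ext i
  fin_cases i
  · simp [dir, Complex.norm_mul_cos_arg]
  · simp [dir, Complex.norm_mul_sin_arg]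

/-- The sine rule without denominators. For `0 ≤ τ ≤ w0 < π` both coefficients are nonnegative,
which places the middle direction in the cone of the outer two. -/
theorem sin_smul_dir (β τ w0 : ℝ) : Real.sin w0 • dir (β + τ) =
    Real.sin (w0 - τ) • dir β + Real.sin τ • dir (β + w0) := by
  ext i
  fin_cases i
  · simp [dir, Real.cos_add, Real.sin_sub]; ring
  · simp [dir, Real.sin_add, Real.sin_sub]; ring

/-- Vertices of the regular polygon relative to its centre, indexed by the integers. -/
noncomputable def spoke (N : ℕ) (r α : ℝ) (k : ℤ) : Plane := r • dir (α + 2 * Real.pi * k / N)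

/-- Outer normals of the sides of the regular polygon, indexed by the integers. -/
noncomputable def outerNormal (N : ℕ) (α : ℝ) (k : ℤ) : Plane :=
  dir (α + (2 * k + 1) * Real.pi / N)

theorem vertex_eq (N : ℕ) (c : Plane) (r α : ℝ) (k : Fin N) :
    vertex N c r α k = c + spoke N r α (k : ℕ) := by
  simp [vertex, spoke, dir]

theorem norm_outerNormal (N : ℕ) (α : ℝ) (k : ℤ) : ‖outerNormal N α k‖ = 1 := norm_dir _

theorem spoke_add_mul {N : ℕ} (hN : 0 < N) (r α : ℝ) (k q : ℤ) :
    spoke N r α (k + N * q) = spoke N r α k := by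
  have : (N : ℝ) ≠ 0 := by positivity
  rw [spoke, spoke, ← dir_periodic (α + 2 * Real.pi * k / N) q]
  congr 2
  push_cast
  field_simp
  ring

theorem outerNormal_add_mul {N : ℕ} (hN : 0 < N) (α : ℝ) (k q : ℤ) :
    outerNormal N α (k + N * q) = outerNormal N α k := by
  have : (N : ℝ) ≠ 0 := by positivity
  rw [outerNormal, outerNormal, ← dir_periodic (α + (2 * k + 1) * Real.pi / N) q]
  congr 1
  push_cast
  field_simp
  ring

/-- Integer indices spare the last vertex a special successor; this reduction returns to `Fin N`. -/
theorem exists_fin_add_mul {N : ℕ} (hN : 0 < N) (k : ℤ) :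
    ∃ (i : Fin N) (q : ℤ), k = (i : ℕ) + N * q := by
  have h1 := Int.emod_nonneg k (by omega : (N : ℤ) ≠ 0)
  have h2 := Int.emod_lt_of_pos k (by omega : (0 : ℤ) < N)
  refine ⟨⟨(k % N).toNat, by omega⟩, k / N, ?_⟩
  have := Int.emod_add_mul_ediv k N
  simp only
  omega

/-- Consecutive multiples of `π/N` never lie strictly on opposite sides of a multiple of `π`, so the
two sines cannot have opposite signs; reduction modulo `N` brings both angles into `[0, π]`. -/
theorem sin_mul_sin_succ {N : ℕ} (hN : 0 < N) (l : ℤ) :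
    0 ≤ Real.sin (l * Real.pi / N) * Real.sin ((l + 1) * Real.pi / N) ∧
      (Real.sin (l * Real.pi / N) * Real.sin ((l + 1) * Real.pi / N) = 0 →
        (N : ℤ) ∣ l ∨ (N : ℤ) ∣ l + 1) := by
  have hN' : (0 : ℝ) < N := by positivity
  obtain ⟨⟨s, hs⟩, q, rfl⟩ := exists_fin_add_mul hN l
  simp only
  have e1 : (((s : ℤ) + N * q : ℤ) : ℝ) * Real.pi / N = s * Real.pi / N + q * Real.pi := by
    push_cast; field_simp
  have e2 : ((((s : ℤ) + N * q : ℤ) : ℝ) + 1) * Real.pi / N =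
      (s + 1) * Real.pi / N + q * Real.pi := by
    push_cast; field_simp; ring
  rw [e1, e2, Real.sin_add_int_mul_pi, Real.sin_add_int_mul_pi]
  have e3 : ((-1 : ℝ) ^ q) * (-1) ^ q = 1 := by
    rw [← mul_zpow]; simp
  have e4 : (-1 : ℝ) ^ q * Real.sin (s * Real.pi / N) *
      ((-1) ^ q * Real.sin ((s + 1) * Real.pi / N)) =
      Real.sin (s * Real.pi / N) * Real.sin ((s + 1) * Real.pi / N) := by
    linear_combination (Real.sin (s * Real.pi / N) * Real.sin ((s + 1) * Real.pi / N)) * e3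
  rw [e4]
  have hs1 : (s : ℝ) + 1 ≤ N := by exact_mod_cast hs
  have hpi := Real.pi_pos
  have a1 : s * Real.pi / N ≤ Real.pi := by
    rw [div_le_iff₀ hN']; nlinarith
  have a2 : (s + 1) * Real.pi / N ≤ Real.pi := by
    rw [div_le_iff₀ hN']; nlinarith
  refine ⟨mul_nonneg (Real.sin_nonneg_of_nonneg_of_le_pi (by positivity) a1)
    (Real.sin_nonneg_of_nonneg_of_le_pi (by positivity) a2), fun h => ?_⟩
  rcases mul_eq_zero.1 h with h | h
  · left
    by_cases h0 : s = 0
    · subst h0; simp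
    · have : (0 : ℝ) < s := by exact_mod_cast Nat.pos_of_ne_zero h0
      refine absurd h (Real.sin_pos_of_pos_of_lt_pi (by positivity) ?_).ne'
      rw [div_lt_iff₀ hN']; nlinarith
  · right
    by_cases h0 : s + 1 = N
    · exact ⟨q + 1, by rw [← h0]; push_cast; ring⟩
    · have : (s : ℝ) + 1 < N := by exact_mod_cast (by omega : s + 1 < N)
      refine absurd h (Real.sin_pos_of_pos_of_lt_pi (by positivity) ?_).ne'
      rw [div_lt_iff₀ hN']; nlinarith

section

variable {N : ℕ} {r α : ℝ}

/-- The inner product is `r` times a cosine; the sum-to-product formula isolates its deficit from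
the inradius, whose sign `sin_mul_sin_succ` controls. -/
theorem inner_outerNormal_spoke (hN : 0 < N) (j k : ℤ) :
    inner ℝ (outerNormal N α k) (spoke N r α j) = r * Real.cos (Real.pi / N) -
      2 * r * (Real.sin ((j - k - 1 : ℤ) * Real.pi / N) *
        Real.sin (((j - k - 1 : ℤ) + 1) * Real.pi / N)) := by
  have : (N : ℝ) ≠ 0 := by positivity
  rw [outerNormal, spoke, inner_smul_right, inner_dir]
  have h := Real.cos_sub_cos (Real.pi / N)
    (α + (2 * k + 1) * Real.pi / N - (α + 2 * Real.pi * j / N))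
  have e1 : (Real.pi / N + (α + (2 * k + 1) * Real.pi / N - (α + 2 * Real.pi * j / N))) / 2 =
      -((j - k - 1 : ℤ) * Real.pi / N) := by push_cast; field_simp; ring
  have e2 : (Real.pi / N - (α + (2 * k + 1) * Real.pi / N - (α + 2 * Real.pi * j / N))) / 2 =
      ((j - k - 1 : ℤ) + 1) * Real.pi / N := by push_cast; field_simp; ring
  rw [e1, e2, Real.sin_neg] at h
  linear_combination (-r) * h

theorem inner_outerNormal_spoke_le (hN : 0 < N) (hr : 0 < r) (j k : ℤ) :
    inner ℝ (outerNormal N α k) (spoke N r α j) ≤ r * Real.cos (Real.pi / N) := by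
  rw [inner_outerNormal_spoke hN]
  have := (sin_mul_sin_succ hN (j - k - 1)).1
  nlinarith [mul_nonneg hr.le this]

theorem dvd_of_inner_outerNormal_spoke_eq (hN : 0 < N) (hr : 0 < r) {j k : ℤ}
    (h : inner ℝ (outerNormal N α k) (spoke N r α j) = r * Real.cos (Real.pi / N)) :
    (N : ℤ) ∣ j - k ∨ (N : ℤ) ∣ j - k - 1 := by
  rw [inner_outerNormal_spoke hN] at h
  have h0 : Real.sin ((j - k - 1 : ℤ) * Real.pi / N) *
        Real.sin (((j - k - 1 : ℤ) + 1) * Real.pi / N) = 0 := by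
    have : 2 * r * (Real.sin ((j - k - 1 : ℤ) * Real.pi / N) *
        Real.sin (((j - k - 1 : ℤ) + 1) * Real.pi / N)) = 0 := by linarith
    exact (mul_eq_zero.1 this).resolve_left (by positivity)
  have := (sin_mul_sin_succ hN (j - k - 1)).2 h0
  rw [sub_add_cancel] at this
  exact this.symm

theorem inner_outerNormal_spoke_self (hN : 0 < N) (k : ℤ) :
    inner ℝ (outerNormal N α k) (spoke N r α k) = r * Real.cos (Real.pi / N) := by
  rw [inner_outerNormal_spoke hN]; simp

theorem inner_outerNormal_spoke_succ (hN : 0 < N) (k : ℤ) :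
    inner ℝ (outerNormal N α k) (spoke N r α (k + 1)) = r * Real.cos (Real.pi / N) := by
  rw [inner_outerNormal_spoke hN]; simp

/-- The index is the integer part of the polar angle in units of `2π/N`; the sine rule then gives
the coefficients. `N ≥ 3` keeps the opening angle below `π`. Inside this cone, `a + b` is the gauge
of the polygon. -/
theorem exists_cone (hN : 3 ≤ N) (hr : 0 < r) (α : ℝ) (y : Plane) : ∃ (k : ℤ) (a b : ℝ),
    0 ≤ a ∧ 0 ≤ b ∧ y = a • spoke N r α k + b • spoke N r α (k + 1) := by
  have hN' : (0 : ℝ) < N := by positivity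
  have hN3 : (3 : ℝ) ≤ N := by exact_mod_cast hN
  have hpi := Real.pi_pos
  obtain ⟨ρ, φ, hρ, rfl⟩ := exists_eq_smul_dir y
  set w0 := 2 * Real.pi / N with hw0
  have hw00 : 0 < w0 := by positivity
  have hw0pi : w0 < Real.pi := by rw [hw0, div_lt_iff₀ hN']; nlinarith
  set k : ℤ := ⌊(φ - α) / w0⌋ with hk
  set τ := φ - α - k * w0 with hτ
  have h1 : 0 ≤ τ := by
    have := (le_div_iff₀ hw00).1 (Int.floor_le ((φ - α) / w0))
    rw [hτ]; linarith
  have h2 : τ < w0 := by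
    have := (div_lt_iff₀ hw00).1 (Int.lt_floor_add_one ((φ - α) / w0))
    rw [hτ]; linarith
  have hs : 0 < Real.sin w0 := Real.sin_pos_of_pos_of_lt_pi hw00 hw0pi
  refine ⟨k, ρ * Real.sin (w0 - τ) / (r * Real.sin w0), ρ * Real.sin τ / (r * Real.sin w0), ?_, ?_, ?_⟩
  · have := Real.sin_nonneg_of_nonneg_of_le_pi (by linarith : 0 ≤ w0 - τ) (by linarith)
    positivity
  · have := Real.sin_nonneg_of_nonneg_of_le_pi h1 (by linarith)
    positivity
  · have e1 : α + 2 * Real.pi * k / N = α + k * w0 := by rw [hw0]; ring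
    have e2 : α + 2 * Real.pi * ((k + 1 : ℤ) : ℝ) / N = α + k * w0 + w0 := by
      rw [hw0]; push_cast; ring
    have e3 : φ = α + k * w0 + τ := by rw [hτ]; ring
    have key := sin_smul_dir (α + k * w0) τ w0
    rw [← e3] at key
    rw [spoke, spoke, e1, e2, smul_smul, smul_smul]
    have e4 : dir φ = (Real.sin w0)⁻¹ • (Real.sin w0 • dir φ) := by
      rw [smul_smul, inv_mul_cancel₀ hs.ne', one_smul]
    rw [e4, key, smul_add, smul_add, smul_smul, smul_smul, smul_smul, smul_smul]
    congr 2 <;> field_simp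

theorem inner_cone_le (hN : 0 < N) (hr : 0 < r) {a b : ℝ} (ha : 0 ≤ a) (hb : 0 ≤ b) (j k : ℤ) :
    inner ℝ (outerNormal N α j) (a • spoke N r α k + b • spoke N r α (k + 1)) ≤
      (a + b) * (r * Real.cos (Real.pi / N)) := by
  rw [inner_add_right, inner_smul_right, inner_smul_right, add_mul]
  gcongr
  · exact inner_outerNormal_spoke_le hN hr _ _
  · exact inner_outerNormal_spoke_le hN hr _ _

theorem inner_cone_self (hN : 0 < N) (a b : ℝ) (k : ℤ) :
    inner ℝ (outerNormal N α k) (a • spoke N r α k + b • spoke N r α (k + 1)) =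
      (a + b) * (r * Real.cos (Real.pi / N)) := by
  rw [inner_add_right, inner_smul_right, inner_smul_right, inner_outerNormal_spoke_self hN,
    inner_outerNormal_spoke_succ hN, add_mul]

theorem inradius_pos (hN : 3 ≤ N) (hr : 0 < r) : 0 < r * Real.cos (Real.pi / N) := by
  have hN3 : (3 : ℝ) ≤ N := by exact_mod_cast hN
  have hpi := Real.pi_pos
  refine mul_pos hr (Real.cos_pos_of_mem_Ioo ⟨?_, ?_⟩)
  · have : 0 < Real.pi / N := by positivity
    linarith
  · rw [div_lt_div_iff₀ (by positivity) two_pos]; nlinarith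

/-- The open regular polygon as an intersection of half planes. -/
noncomputable def regPolygon (N : ℕ) (c : Plane) (r α : ℝ) : Set Plane :=
  openPolygon (fun k : Fin N => outerNormal N α (k : ℕ))
    fun k => r * Real.cos (Real.pi / N) + inner ℝ (outerNormal N α (k : ℕ)) c

theorem mem_regPolygon (hN : 0 < N) {c x : Plane} : x ∈ regPolygon N c r α ↔
    ∀ k : ℤ, inner ℝ (outerNormal N α k) (x - c) < r * Real.cos (Real.pi / N) := by
  constructor
  · intro h k
    obtain ⟨i, q, rfl⟩ := exists_fin_add_mul hN k
    have := h i
    rw [gap] at this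
    rw [outerNormal_add_mul hN, inner_sub_right]
    linarith
  · intro h k
    have := h (k : ℕ)
    rw [inner_sub_right] at this
    rw [gap]
    linarith

variable {c : Plane}

theorem mem_hull_of_cone (hN : 0 < N) {a b : ℝ} (ha : 0 ≤ a) (hb : 0 ≤ b)
    (hab : a + b ≤ 1) (hc : c ∈ convexHull ℝ (Set.range (vertex N c r α))) (k : ℤ) :
    c + (a • spoke N r α k + b • spoke N r α (k + 1)) ∈
      convexHull ℝ (Set.range (vertex N c r α)) := by
  have hv : ∀ k : ℤ, c + spoke N r α k ∈ convexHull ℝ (Set.range (vertex N c r α)) := by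
    intro k
    obtain ⟨i, q, rfl⟩ := exists_fin_add_mul hN k
    rw [spoke_add_mul hN, ← vertex_eq]
    exact subset_convexHull ℝ _ ⟨i, rfl⟩
  have h := (convex_convexHull ℝ (Set.range (vertex N c r α))).sum_mem
    (t := Finset.univ) (w := ![1 - a - b, a, b])
    (z := ![c, c + spoke N r α k, c + spoke N r α (k + 1)]) ?_ ?_ ?_
  · convert h using 1
    simp [Fin.sum_univ_three]
    module
  · intro i _; fin_cases i
    · simp; linarith
    · simpa
    · simpa
  · simp [Fin.sum_univ_three]; ring
  · intro i _; fin_cases i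
    · simpa
    · exact hv k
    · exact hv (k + 1)

/-- Expanding minus one spoke in a cone of consecutive spokes gives a vanishing nonnegative
combination of spokes; normalised, it exhibits the centre as a convex combination of vertices. -/
theorem center_mem_hull (hN : 3 ≤ N) (hr : 0 < r) :
    c ∈ convexHull ℝ (Set.range (vertex N c r α)) := by
  have hN0 : 0 < N := by omega
  have hv : ∀ k : ℤ, c + spoke N r α k ∈ convexHull ℝ (Set.range (vertex N c r α)) := by
    intro k
    obtain ⟨i, q, rfl⟩ := exists_fin_add_mul hN0 k
    rw [spoke_add_mul hN0, ← vertex_eq]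
    exact subset_convexHull ℝ _ ⟨i, rfl⟩
  obtain ⟨k, a, b, ha, hb, h⟩ := exists_cone hN hr α (-spoke N r α 0)
  have hs : 0 < 1 + a + b := by positivity
  have hmem := (convex_convexHull ℝ (Set.range (vertex N c r α))).sum_mem
    (t := Finset.univ) (w := ![(1 + a + b)⁻¹, (1 + a + b)⁻¹ * a, (1 + a + b)⁻¹ * b])
    (z := ![c + spoke N r α 0, c + spoke N r α k, c + spoke N r α (k + 1)]) ?_ ?_ ?_
  · convert hmem using 1
    simp only [Fin.sum_univ_three, Matrix.cons_val]
    have e : (1 + a + b)⁻¹ • (c + spoke N r α 0) + ((1 + a + b)⁻¹ * a) • (c + spoke N r α k) +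
        ((1 + a + b)⁻¹ * b) • (c + spoke N r α (k + 1)) =
        ((1 + a + b)⁻¹ * (1 + a + b)) • c + (1 + a + b)⁻¹ • (spoke N r α 0 +
          (a • spoke N r α k + b • spoke N r α (k + 1))) := by module
    rw [e, ← h, inv_mul_cancel₀ hs.ne']
    simp
  · intro i _; fin_cases i
    · simp; positivity
    · simp; positivity
    · simp; positivity
  · simp [Fin.sum_univ_three]; field_simp
  · intro i _; fin_cases i
    · exact hv 0
    · exact hv k
    · exact hv (k + 1)

/-- Half planes contain the vertices, hence the hull. Conversely, the inequality for the side facing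
the cone of `x - c` says `a + b ≤ 1`, so `x` lies in the triangle of the centre and two vertices. -/
theorem mem_hull_iff (hN : 3 ≤ N) (hr : 0 < r) {x : Plane} :
    x ∈ convexHull ℝ (Set.range (vertex N c r α)) ↔
      ∀ k : ℤ, inner ℝ (outerNormal N α k) (x - c) ≤ r * Real.cos (Real.pi / N) := by
  have hN0 : 0 < N := by omega
  constructor
  · intro hx k
    have hsub : convexHull ℝ (Set.range (vertex N c r α)) ⊆
        {x | inner ℝ (outerNormal N α k) x ≤
          r * Real.cos (Real.pi / N) + inner ℝ (outerNormal N α k) c} := by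
      refine convexHull_min ?_ (convex_halfSpace_le (innerSL ℝ (outerNormal N α k)).isLinear _)
      rintro _ ⟨i, rfl⟩
      rw [vertex_eq]
      have := inner_outerNormal_spoke_le (α := α) hN0 hr (i : ℕ) k
      simp only [Set.mem_ofPred_eq, inner_add_right]
      linarith
    have := hsub hx
    simp only [Set.mem_ofPred_eq] at this
    rw [inner_sub_right]; linarith
  · intro h
    obtain ⟨k, a, b, ha, hb, hy⟩ := exists_cone hN hr α (x - c)
    have h1 := h k
    rw [hy, inner_cone_self hN0] at h1
    have h2 := inradius_pos hN hr
    have h3 : a + b ≤ 1 := by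
      by_contra h4
      nlinarith
    have := mem_hull_of_cone hN0 ha hb h3 (center_mem_hull (c := c) (α := α) hN hr) k
    rwa [← hy, add_sub_cancel] at this

theorem interior_hull (hN : 3 ≤ N) (hr : 0 < r) :
    interior (convexHull ℝ (Set.range (vertex N c r α))) = regPolygon N c r α := by
  have hN0 : 0 < N := by omega
  apply Set.Subset.antisymm
  · intro x hx
    rw [mem_regPolygon hN0]
    intro k
    obtain ⟨ε, hε, hball⟩ := Metric.isOpen_iff.1 isOpen_interior x hx
    -- An interior point can still be moved outwards along the normal, so its inequality is strict.
    have h1 : x + (ε / 2) • outerNormal N α k ∈ Metric.ball x ε := by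
      rw [mem_ball_iff_norm, add_sub_cancel_left, norm_smul, norm_outerNormal, Real.norm_eq_abs,
        abs_of_pos (by positivity)]
      linarith
    have h2 := (mem_hull_iff hN hr).1 (interior_subset (hball h1)) k
    rw [add_sub_right_comm, inner_add_right, inner_smul_right, real_inner_self_eq_norm_sq,
      norm_outerNormal] at h2
    linarith
  · refine interior_maximal (fun x hx => ?_) (isOpen_openPolygon _ _)
    exact (mem_hull_iff hN hr).2 fun k => ((mem_regPolygon hN0).1 hx k).le

theorem isBounded_regPolygon (hN : 3 ≤ N) (hr : 0 < r) :
    Bornology.IsBounded (regPolygon N c r α) := by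
  rw [← interior_hull hN hr]
  exact (((Set.finite_range _).isCompact_convexHull ℝ).isBounded).subset interior_subset

theorem center_mem_regPolygon (hN : 3 ≤ N) (hr : 0 < r) : c ∈ regPolygon N c r α := by
  rw [mem_regPolygon (by omega)]
  intro k
  simpa using inradius_pos hN hr

theorem closure_regPolygon (hN : 3 ≤ N) (hr : 0 < r) :
    closure (regPolygon N c r α) = convexHull ℝ (Set.range (vertex N c r α)) := by
  have hcl : IsClosed (convexHull ℝ (Set.range (vertex N c r α))) :=
    ((Set.finite_range _).isCompact_convexHull ℝ).isClosed
  rw [← interior_hull hN hr,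
    (convex_convexHull ℝ _).closure_interior_eq_closure_of_nonempty_interior, hcl.closure_eq]
  rw [interior_hull hN hr]
  exact ⟨c, center_mem_regPolygon hN hr⟩

/-- The side of the regular polygon between two consecutive vertices. -/
noncomputable def side (N : ℕ) (c : Plane) (r α : ℝ) (k : ℤ) : Set Plane :=
  segment ℝ (c + spoke N r α k) (c + spoke N r α (k + 1))

theorem mem_side {x : Plane} {k : ℤ} : x ∈ side N c r α k ↔ ∃ a b : ℝ, 0 ≤ a ∧ 0 ≤ b ∧ a + b = 1 ∧
    x - c = a • spoke N r α k + b • spoke N r α (k + 1) := by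
  constructor
  · rintro ⟨a, b, ha, hb, hab, rfl⟩
    refine ⟨a, b, ha, hb, hab, ?_⟩
    obtain rfl : b = 1 - a := by linarith
    module
  · rintro ⟨a, b, ha, hb, hab, h⟩
    refine ⟨a, b, ha, hb, hab, ?_⟩
    rw [smul_add, smul_add, add_add_add_comm, ← add_smul, hab, one_smul, ← h, add_sub_cancel]

/-- A hull point whose gauge `a + b` is below `1` satisfies all the inequalities strictly; gauge `1`
is exactly the side facing the cone. -/
theorem frontier_regPolygon (hN : 3 ≤ N) (hr : 0 < r) :
    frontier (regPolygon N c r α) = ⋃ k : Fin N, side N c r α (k : ℕ) := by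
  have hN0 : 0 < N := by omega
  have hh := inradius_pos hN hr
  have ho : IsOpen (regPolygon N c r α) := isOpen_openPolygon _ _
  rw [ho.frontier_eq, closure_regPolygon hN hr]
  ext x
  simp only [Set.mem_sdiff, Set.mem_iUnion]
  constructor
  · rintro ⟨hx, hx'⟩
    obtain ⟨k, a, b, ha, hb, hy⟩ := exists_cone hN hr α (x - c)
    have h1 := (mem_hull_iff hN hr).1 hx k
    rw [hy, inner_cone_self hN0] at h1
    have h3 : a + b = 1 := by
      refine le_antisymm (by by_contra h4; nlinarith) ?_
      by_contra h4
      refine hx' ((mem_regPolygon hN0).2 fun j => ?_)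
      rw [hy]
      refine (inner_cone_le hN0 hr ha hb j k).trans_lt ?_
      nlinarith
    obtain ⟨i, q, rfl⟩ := exists_fin_add_mul hN0 k
    refine ⟨i, mem_side.2 ⟨a, b, ha, hb, h3, ?_⟩⟩
    rw [hy, spoke_add_mul hN0, add_right_comm, spoke_add_mul hN0]
  · rintro ⟨k, hk⟩
    obtain ⟨a, b, ha, hb, hab, hy⟩ := mem_side.1 hk
    constructor
    · have := mem_hull_of_cone hN0 ha hb hab.le (center_mem_hull (c := c) (α := α) hN hr) (k : ℕ)
      rwa [← hy, add_sub_cancel] at this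
    · intro h
      have := (mem_regPolygon hN0).1 h (k : ℕ)
      rw [hy, inner_cone_self hN0, hab, one_mul] at this
      exact lt_irrefl _ this

/-- If a relative interior point of side `j` were on side `i`, both ends of side `j` would lie on
the line of side `i`. Then `j` and `j + 1` are each congruent to `i` or `i + 1` modulo `N`, which
forces `i = j` or `N ∣ 2`. -/
theorem side_inter_subset (hN : 3 ≤ N) (hr : 0 < r) {i j : Fin N} (hij : i ≠ j) :
    side N c r α (i : ℕ) ∩ side N c r α (j : ℕ) ⊆
      {c + spoke N r α (j : ℕ), c + spoke N r α ((j : ℕ) + 1)} := by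
  have hN0 : 0 < N := by omega
  rintro x ⟨hi, hj⟩
  obtain ⟨a, b, ha, hb, hab, hy⟩ := mem_side.1 hj
  obtain ⟨a', b', ha', hb', hab', hy'⟩ := mem_side.1 hi
  have h1 : inner ℝ (outerNormal N α (i : ℕ)) (x - c) = r * Real.cos (Real.pi / N) := by
    rw [hy', inner_cone_self hN0, hab', one_mul]
  rw [hy, inner_add_right, inner_smul_right, inner_smul_right] at h1
  have hle1 := inner_outerNormal_spoke_le (α := α) hN0 hr (j : ℕ) (i : ℕ)
  have hle2 := inner_outerNormal_spoke_le (α := α) hN0 hr ((j : ℕ) + 1) (i : ℕ)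
  by_contra hx
  simp only [Set.mem_insert_iff, Set.mem_singleton_iff, not_or] at hx
  have ha0 : 0 < a := by
    refine ha.lt_of_ne fun h => hx.2 ?_
    rw [← h, zero_add] at hab
    rw [← h, hab, zero_smul, one_smul, zero_add] at hy
    rw [← hy, add_sub_cancel]
  have hb0 : 0 < b := by
    refine hb.lt_of_ne fun h => hx.1 ?_
    rw [← h, add_zero] at hab
    rw [← h, hab, zero_smul, one_smul, add_zero] at hy
    rw [← hy, add_sub_cancel]
  obtain rfl : b = 1 - a := by linarith
  have e1 := dvd_of_inner_outerNormal_spoke_eq hN0 hr (le_antisymm hle1 (by nlinarith))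
  have e2 := dvd_of_inner_outerNormal_spoke_eq hN0 hr (le_antisymm hle2 (by nlinarith))
  have hlt1 := i.2
  have hlt2 := j.2
  have hne : (i : ℕ) ≠ j := fun h => hij (Fin.ext h)
  have hdvd : ∀ d : ℤ, (N : ℤ) ∣ d → d ≠ 0 → N ≤ |d| := fun d hd h0 =>
    Int.le_of_dvd (abs_pos.2 h0) ((dvd_abs _ _).2 hd)
  rcases e1 with e1 | e1
  · have := hdvd _ e1 (by omega)
    rcases abs_cases (((j : ℕ) : ℤ) - ((i : ℕ) : ℤ)) with h | h <;> omega
  · rcases e2 with e2 | e2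
    · have := dvd_sub e2 e1
      have := hdvd _ this (by omega)
      rw [show ((j : ℕ) : ℤ) + 1 - ((i : ℕ) : ℤ) - (((j : ℕ) : ℤ) - ((i : ℕ) : ℤ) - 1) = 2 by ring]
        at this
      norm_num at this
      omega
    · have := hdvd _ e2 (by omega)
      rcases abs_cases (((j : ℕ) : ℤ) + 1 - ((i : ℕ) : ℤ) - 1) with h | h <;> omega

theorem dist_dir (a b : ℝ) : dist (dir a) (dir (a + 2 * b)) = 2 * |Real.sin b| := by
  have h : dist (dir a) (dir (a + 2 * b)) ^ 2 = (2 * |Real.sin b|) ^ 2 := by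
    rw [dist_eq_norm, norm_sub_sq_real, norm_dir, norm_dir, inner_dir, mul_pow, sq_abs,
      show a - (a + 2 * b) = -(2 * b) by ring, Real.cos_neg, Real.cos_two_mul]
    linarith [Real.sin_sq_add_cos_sq b]
  exact (pow_left_inj₀ dist_nonneg (by positivity) two_ne_zero).1 h

/-- The sides overlap only in finite sets, which are null for one-dimensional Hausdorff measure, so
the chord lengths add up. -/
theorem perimeter_regPolygon (hN : 3 ≤ N) (hr : 0 < r) :
    perimeter (regPolygon N c r α) = 2 * N * r * Real.sin (Real.pi / N) := by
  have hN0 : 0 < N := by omega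
  have hN' : (0 : ℝ) < N := by positivity
  have hN1 : (1 : ℝ) ≤ N := by exact_mod_cast hN0
  have hpi := Real.pi_pos
  have hs : 0 ≤ Real.sin (Real.pi / N) := Real.sin_nonneg_of_nonneg_of_le_pi (by positivity)
    (by rw [div_le_iff₀ hN']; nlinarith)
  have : NullSingletonClass (μH[1] : Measure Plane) :=
    Measure.nullSingletonClass_hausdorff _ one_pos
  have hlen : ∀ k : Fin N, μH[1] (side N c r α (k : ℕ)) =
      ENNReal.ofReal (2 * r * Real.sin (Real.pi / N)) := by
    intro k
    rw [side, hausdorffMeasure_segment, edist_dist, dist_add_left, spoke, spoke, dist_smul₀,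
      show α + 2 * Real.pi * (((k : ℕ) + 1 : ℤ) : ℝ) / N =
        α + 2 * Real.pi * (((k : ℕ) : ℤ) : ℝ) / N + 2 * (Real.pi / N) by push_cast; ring,
      dist_dir, abs_of_nonneg hs, Real.norm_eq_abs, abs_of_pos hr]
    congr 1; ring
  rw [perimeter, frontier_regPolygon hN hr, measure_iUnion₀]
  · simp_rw [hlen]
    rw [tsum_fintype, Finset.sum_const, Finset.card_univ, Fintype.card_fin, nsmul_eq_mul,
      ENNReal.toReal_mul, ENNReal.toReal_ofReal (by positivity)]
    simp; ring
  · intro i j hij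
    exact measure_mono_null (side_inter_subset hN hr hij)
      ((Set.toFinite _).measure_zero _)
  · intro k
    have : IsCompact (side N c r α (k : ℕ)) := by
      rw [side, segment_eq_image]
      exact isCompact_Icc.image (by fun_prop)
    exact this.measurableSet.nullMeasurableSet

end


/-! ### The variational eigenvalue -/

theorem rayleighQuotients_nonneg (Ω : Set Plane) : ∀ q ∈ rayleighQuotients Ω, 0 ≤ q := by
  rintro q ⟨u, G, -, -, -, rfl⟩
  exact div_nonneg (integral_nonneg fun x => by positivity) (integral_nonneg fun x => by positivity)

/-- The product form needs no division and so remains true for `u` of zero norm. -/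
theorem neumannMu1_le {Ω : Set Plane} {u : Plane → ℝ} {G : Plane → Plane} (hu : IsH1With Ω u G)
    (hu0 : ∫ x in Ω, u x = 0) : neumannMu1 Ω * ∫ x in Ω, u x ^ 2 ≤ ∫ x in Ω, ‖G x‖ ^ 2 := by
  rcases (integral_nonneg fun x => sq_nonneg (u x) : 0 ≤ ∫ x in Ω, u x ^ 2).eq_or_lt with h0 | h0
  · rw [← h0, mul_zero]
    exact integral_nonneg fun x => by positivity
  · rw [← le_div_iff₀ h0]
    exact csInf_le ⟨0, rayleighQuotients_nonneg Ω⟩ ⟨u, G, hu, hu0, h0, rfl⟩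

theorem setIntegral_sq_pos {Ω : Set Plane} (ho : IsOpen Ω) (hb : Bornology.IsBounded Ω)
    {φ : Plane → ℝ} (hφ : Continuous φ) {x₀ : Plane} (hx : x₀ ∈ Ω) (h0 : φ x₀ ≠ 0) :
    0 < ∫ x in Ω, φ x ^ 2 := by
  have hs : IsOpen (Function.support fun x => φ x ^ 2) := (hφ.pow 2).isOpen_support
  rw [integral_pos_iff_support_of_nonneg (fun x => sq_nonneg _)
    (integrable_restrict_of_continuous hb (hφ.pow 2)),
    Measure.restrict_apply hs.measurableSet]
  exact (hs.inter ho).measure_pos volume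
    ⟨x₀, by simpa using h0, hx⟩

/-- If the Poincaré inequality holds with a constant which is an eigenvalue, then this is the first
eigenvalue. -/
theorem neumannMu1_eq {Ω : Set Plane} (ho : IsOpen Ω) (hb : Bornology.IsBounded Ω) {μ : ℝ}
    (hμ : 0 < μ) (hP : ∀ (u : Plane → ℝ) (G : Plane → Plane), IsH1With Ω u G →
      ∫ x in Ω, u x = 0 → μ * ∫ x in Ω, u x ^ 2 ≤ ∫ x in Ω, ‖G x‖ ^ 2)
    {φ : Plane → ℝ} {F : Plane → Plane} (hφ : IsNeumannEigenpair Ω φ F μ) {x₀ : Plane}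
    (hx : x₀ ∈ Ω) (h0 : φ x₀ ≠ 0) : neumannMu1 Ω = μ := by
  have hpos := setIntegral_sq_pos ho hb hφ.continuous hx h0
  -- Testing the eigenvalue equation with the constant `1` gives `0 = μ ∫ φ`.
  have hmean : ∫ x in Ω, φ x = 0 := by
    have h1 : IsH1With Ω (fun _ => 1) (fun _ => 0) :=
      isH1With_of_contDiff hb contDiff_const continuous_const (by simp)
    have := hφ.integral_inner _ _ h1
    simpa [hμ.ne'] using this
  have henergy : ∫ x in Ω, ‖F x‖ ^ 2 = μ * ∫ x in Ω, φ x ^ 2 := by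
    have := hφ.integral_inner _ _ hφ.isH1
    simpa only [real_inner_self_eq_norm_sq, sq] using this
  apply le_antisymm
  · have := neumannMu1_le hφ.isH1 hmean
    rw [henergy] at this
    exact le_of_mul_le_mul_right this hpos
  · refine le_csInf ⟨_, φ, F, hφ.isH1, hmean, hpos, rfl⟩ ?_
    rintro q ⟨u, G, hu, hu0, hupos, rfl⟩
    rw [le_div_iff₀ hupos]
    exact hP u G hu hu0

theorem closure_openPolygon_subset {K : Type*} (n : K → Plane) (b : K → ℝ) {x : Plane}
    (hx : x ∈ closure (openPolygon n b)) (k : K) : 0 ≤ gap n b k x := by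
  have hcl : IsClosed {x | 0 ≤ gap n b k x} :=
    isClosed_le continuous_const (contDiff_gap n b k).continuous
  exact closure_minimal (fun y hy => (hy k).le) hcl hx

theorem gap_reflect {K : Type*} (n : K → Plane) (b : K → ℝ) (j k : K) (x : Plane) :
    gap n b j (x + (2 * gap n b k x) • n k) =
      gap n b j x - 2 * gap n b k x * inner ℝ (n j) (n k) := by
  simp only [gap, inner_add_right, inner_smul_right]; ring

/-! ### The square -/

section Square

variable {n : Fin 4 → Plane} {b : Fin 4 → ℝ} {h : ℝ}

/-- The eigenfunction `cos (π p S) cos (π q T)` of a square, where `S` and `T` are the normalized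
distances to two adjacent sides. -/
noncomputable def squareWave (n : Fin 4 → Plane) (b : Fin 4 → ℝ) (h : ℝ) (p q : ℤ) :
    C(Plane, ℝ) :=
  ⟨fun x => Real.cos (p * (Real.pi * gap n b 0 x / (2 * h))) *
    Real.cos (q * (Real.pi * gap n b 1 x / (2 * h))), by
    have h0 := (contDiff_gap n b 0).continuous
    have h1 := (contDiff_gap n b 1).continuous
    fun_prop⟩

/-- The product of cosines is half the sum of two plane waves. It is even in each normalized
distance, which handles two sides, and has period `4h` in each gap, which handles the opposite ones.
-/
theorem isNeumannEigenpair_squareWave (hb : Bornology.IsBounded (openPolygon n b)) (hh : 0 < h)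
    (hn : ∀ k, ‖n k‖ = 1) (h01 : inner ℝ (n 0) (n 1) = 0) (h2 : n 2 = -n 0) (h3 : n 3 = -n 1)
    (hb2 : b 0 + b 2 = 2 * h) (hb3 : b 1 + b 3 = 2 * h) (p q : ℤ) :
    ∃ F, IsNeumannEigenpair (openPolygon n b) (squareWave n b h p q) F
      ((p ^ 2 + q ^ 2) * (Real.pi ^ 2 / (4 * h ^ 2))) := by
  set s := Real.pi / (2 * h) with hs
  have h10 : inner ℝ (n 1) (n 0) = 0 := by rw [real_inner_comm, h01]
  have hn0 : inner ℝ (n 0) (n 0) = 1 := by rw [real_inner_self_eq_norm_sq, hn]; norm_num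
  have hn1 : inner ℝ (n 1) (n 1) = 1 := by rw [real_inner_self_eq_norm_sq, hn]; norm_num
  have hval : ∀ x, squareWave n b h p q x = Real.cos (p * (s * gap n b 0 x)) *
      Real.cos (q * (s * gap n b 1 x)) := by
    intro x
    rw [hs]
    simp only [squareWave, ContinuousMap.coe_mk]
    congr 3 <;> ring
  refine ⟨_, isNeumannEigenpair_wave hb hn (J := Fin 2) (fun _ => 1 / 2)
    ![s * (p * b 0 + q * b 1), s * (p * b 0 - q * b 1)]
    ![-(s * p) • n 0 - (s * q) • n 1, -(s * p) • n 0 + (s * q) • n 1] _ ?_ ?_ ?_⟩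
  · have e : Real.pi ^ 2 / (4 * h ^ 2) = s ^ 2 := by rw [hs]; ring
    intro j
    rw [e]
    have hsq : ∀ a d : ℝ, ‖a • n 0 + d • n 1‖ ^ 2 = a ^ 2 + d ^ 2 := fun a d => by
      rw [norm_add_sq_real, norm_smul, norm_smul, hn, hn, real_inner_smul_left, inner_smul_right,
        h01, Real.norm_eq_abs, Real.norm_eq_abs, mul_one, mul_one, sq_abs, sq_abs]
      ring
    fin_cases j
    · simp only [Fin.zero_eta, Matrix.cons_val_zero]
      rw [sub_eq_add_neg, ← neg_smul, hsq]
      ring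
    · simp only [Fin.mk_one, Matrix.cons_val_one, Matrix.cons_val_zero]
      rw [hsq]
      ring
  · intro x
    rw [hval, Fin.sum_univ_two]
    simp only [Matrix.cons_val_zero, Matrix.cons_val_one, inner_sub_left, inner_add_left,
      real_inner_smul_left]
    rw [show -(s * p) * inner ℝ (n 0) x - s * q * inner ℝ (n 1) x + s * (p * b 0 + q * b 1) =
        p * (s * gap n b 0 x) + q * (s * gap n b 1 x) by rw [gap, gap]; ring,
      show -(s * p) * inner ℝ (n 0) x + s * q * inner ℝ (n 1) x + s * (p * b 0 - q * b 1) =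
        p * (s * gap n b 0 x) - q * (s * gap n b 1 x) by rw [gap, gap]; ring,
      Real.cos_add, Real.cos_sub]
    ring
  · have hper : ∀ (m : ℤ) (t g : ℝ), t = 2 * h - g → Real.cos (m * (s * (g + 2 * t))) =
        Real.cos (m * (s * g)) := by
      rintro m t g rfl
      rw [← Real.cos_int_mul_two_pi_sub (m * (s * g)) m]
      congr 1
      rw [hs]
      field_simp
      ring
    have g2 : ∀ x, gap n b 2 x = 2 * h - gap n b 0 x := fun x => by
      simp only [gap, h2, inner_neg_left]; linarith
    have g3 : ∀ x, gap n b 3 x = 2 * h - gap n b 1 x := fun x => by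
      simp only [gap, h3, inner_neg_left]; linarith
    intro k x
    rw [hval, hval, gap_reflect, gap_reflect]
    fin_cases k
    · simp only [Fin.zero_eta, hn0, h10]
      rw [show gap n b 0 x - 2 * gap n b 0 x * 1 = -gap n b 0 x by ring]
      simp
    · simp only [Fin.mk_one, hn1, h01]
      rw [show gap n b 1 x - 2 * gap n b 1 x * 1 = -gap n b 1 x by ring]
      simp
    · simp only [Fin.reduceFinMk, h2, inner_neg_right, hn0, h10]
      rw [show gap n b 0 x - 2 * gap n b 2 x * -1 = gap n b 0 x + 2 * gap n b 2 x by ring,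
        hper _ _ _ (g2 x)]
      simp
    · simp only [Fin.reduceFinMk, h3, inner_neg_right, hn1, h01]
      rw [show gap n b 1 x - 2 * gap n b 3 x * -1 = gap n b 1 x + 2 * gap n b 3 x by ring,
        hper _ _ _ (g3 x)]
      simp

theorem squareWave_mul (p q p' q' : ℤ) : squareWave n b h p q * squareWave n b h p' q' =
    (1 / 4 : ℝ) • (squareWave n b h (p + p') (q + q') + squareWave n b h (p + p') (q - q') +
      squareWave n b h (p - p') (q + q') + squareWave n b h (p - p') (q - q')) := by
  ext x
  simp only [squareWave, ContinuousMap.mul_apply, ContinuousMap.coe_mk, ContinuousMap.smul_apply,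
    ContinuousMap.add_apply, smul_eq_mul, Int.cast_add, Int.cast_sub, add_mul, sub_mul,
    Real.cos_add, Real.cos_sub]
  ring

theorem neumannMu1_square (hb : Bornology.IsBounded (openPolygon n b)) (hh : 0 < h)
    (hn : ∀ k, ‖n k‖ = 1) (h01 : inner ℝ (n 0) (n 1) = 0) (h2 : n 2 = -n 0) (h3 : n 3 = -n 1)
    (c : Plane) (hc : ∀ k, b k = h + inner ℝ (n k) c)
    (hinj : ∀ z, inner ℝ (n 0) z = 0 → inner ℝ (n 1) z = 0 → z = 0) :
    neumannMu1 (openPolygon n b) = Real.pi ^ 2 / (4 * h ^ 2) := by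
  have ho := isOpen_openPolygon n b
  have hb2 : b 0 + b 2 = 2 * h := by rw [hc, hc, h2, inner_neg_left]; ring
  have hb3 : b 1 + b 3 = 2 * h := by rw [hc, hc, h3, inner_neg_left]; ring
  have hpi := Real.pi_pos
  have hμ : 0 < Real.pi ^ 2 / (4 * h ^ 2) := by positivity
  have heig := isNeumannEigenpair_squareWave hb hh hn h01 h2 h3 hb2 hb3
  have hmem : ∀ p q, squareWave n b h p q ∈
      Submodule.span ℝ (Set.range fun i : ℤ × ℤ => squareWave n b h i.1 i.2) := fun p q =>
    Submodule.subset_span ⟨(p, q), rfl⟩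
  obtain ⟨F, hF⟩ := heig 1 0
  have h10 : inner ℝ (n 1) (n 0) = 0 := by rw [real_inner_comm, h01]
  have hn0 : inner ℝ (n 0) (n 0) = 1 := by rw [real_inner_self_eq_norm_sq, hn]; norm_num
  have hgap : ∀ k, gap n b k (c + (h / 2) • n 0) = h - h / 2 * inner ℝ (n k) (n 0) := fun k => by
    rw [gap, hc, inner_add_right, inner_smul_right]; ring
  refine neumannMu1_eq ho hb hμ (fun u G hu hu0 => ?_) (φ := squareWave n b h 1 0) (F := F)
    (by simpa using hF) (x₀ := c + (h / 2) • n 0) ?_ ?_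
  · refine poincare_of_eigenfunctions hb ho.measurableSet hμ
      (Set.range fun i : ℤ × ℤ => squareWave n b h i.1 i.2) ?_ ?_ ?_ ?_ hu hu0
    · rintro _ ⟨⟨p, q⟩, rfl⟩
      obtain ⟨H, hH⟩ := heig p q
      refine ⟨H, _, hH, ?_⟩
      by_cases h0 : p = 0 ∧ q = 0
      · left
        obtain ⟨rfl, rfl⟩ := h0
        exact ⟨by simp, 1, fun x _ => by simp [squareWave]⟩
      · right
        have : 1 ≤ p ^ 2 + q ^ 2 := by
          have h1 : p ^ 2 + q ^ 2 ≠ 0 := by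
            intro h1
            exact h0 ⟨by nlinarith [sq_nonneg p, sq_nonneg q],
              by nlinarith [sq_nonneg p, sq_nonneg q]⟩
          have : 0 ≤ p ^ 2 + q ^ 2 := by positivity
          omega
        have : (1 : ℝ) ≤ (p : ℝ) ^ 2 + (q : ℝ) ^ 2 := by exact_mod_cast this
        exact le_mul_of_one_le_left hμ.le this
    · convert hmem 0 0 using 1
      ext x
      simp [squareWave]
    · rintro _ ⟨⟨p, q⟩, rfl⟩ _ ⟨⟨p', q'⟩, rfl⟩
      simp only [squareWave_mul]
      exact Submodule.smul_mem _ _ (Submodule.add_mem _ (Submodule.add_mem _ (Submodule.add_mem _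
        (hmem _ _) (hmem _ _)) (hmem _ _)) (hmem _ _))
    · intro x hx y hy hxy
      by_contra hcon
      push Not at hcon
      have e0 := hcon _ ⟨(1, 0), rfl⟩
      have e1 := hcon _ ⟨(0, 1), rfl⟩
      simp only [squareWave, ContinuousMap.coe_mk, Int.cast_one, Int.cast_zero, zero_mul,
        Real.cos_zero, one_mul, mul_one] at e0 e1
      -- Both normalized distances stay in `[0, π]`, where `cos` is injective, so the waves `(1, 0)`
      -- and `(0, 1)` already separate points.
      have hIcc : ∀ z ∈ closure (openPolygon n b), ∀ j k, b j + b k = 2 * h → n k = -n j →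
          Real.pi * gap n b j z / (2 * h) ∈ Set.Icc 0 Real.pi := by
        intro z hz j k hjk hnk
        have z1 := closure_openPolygon_subset n b hz j
        have z2 := closure_openPolygon_subset n b hz k
        have z3 : gap n b k z = 2 * h - gap n b j z := by
          simp only [gap, hnk, inner_neg_left]; linarith
        refine ⟨by positivity, ?_⟩
        rw [div_le_iff₀ (by positivity)]
        exact mul_le_mul_of_nonneg_left (by linarith) hpi.le
      have f0 := Real.injOn_cos (hIcc x hx 0 2 hb2 h2) (hIcc y hy 0 2 hb2 h2) e0
      have f1 := Real.injOn_cos (hIcc x hx 1 3 hb3 h3) (hIcc y hy 1 3 hb3 h3) e1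
      field_simp at f0 f1
      simp only [gap] at f0 f1
      refine hxy (sub_eq_zero.1 (hinj _ ?_ ?_))
      · rw [inner_sub_right]; linarith
      · rw [inner_sub_right]; linarith
  · intro k
    rw [hgap]
    have : inner ℝ (n k) (n 0) ≤ 1 := by
      simpa [hn] using real_inner_le_norm (n k) (n 0)
    nlinarith
  · simp only [squareWave, ContinuousMap.coe_mk, hgap, hn0, Int.cast_zero, zero_mul,
      Real.cos_zero, mul_one, Int.cast_one, one_mul]
    rw [show Real.pi * (h - h / 2) / (2 * h) = Real.pi / 4 by field_simp; norm_num,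
      Real.cos_pi_div_four]
    positivity

end Square


/-! ### The equilateral triangle as an alcove -/

section Alcove

/-- Three complex numbers of modulus one with product one are determined up to order by their
sum. -/
theorem unit_triple_eq {a₀ a₁ a₂ b₀ b₁ b₂ : ℂ} (ha₀ : ‖a₀‖ = 1) (ha₁ : ‖a₁‖ = 1) (ha₂ : ‖a₂‖ = 1)
    (hb₀ : ‖b₀‖ = 1) (hb₁ : ‖b₁‖ = 1) (hb₂ : ‖b₂‖ = 1) (ha : a₀ * a₁ * a₂ = 1)
    (hb : b₀ * b₁ * b₂ = 1) (hs : a₀ + a₁ + a₂ = b₀ + b₁ + b₂) :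
    (b₀ = a₀ ∧ b₁ = a₁ ∧ b₂ = a₂) ∨ (b₀ = a₀ ∧ b₁ = a₂ ∧ b₂ = a₁) ∨
    (b₀ = a₁ ∧ b₁ = a₀ ∧ b₂ = a₂) ∨ (b₀ = a₁ ∧ b₁ = a₂ ∧ b₂ = a₀) ∨
    (b₀ = a₂ ∧ b₁ = a₀ ∧ b₂ = a₁) ∨ (b₀ = a₂ ∧ b₁ = a₁ ∧ b₂ = a₀) := by
  have hconj : ∀ z : ℂ, ‖z‖ = 1 → z * starRingEnd ℂ z = 1 := fun z hz => by
    rw [Complex.mul_conj, Complex.normSq_eq_norm_sq, hz]; norm_num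
  have hne : ∀ z : ℂ, ‖z‖ = 1 → z ≠ 0 := fun z hz h => by simp [h] at hz
  have hs' := congrArg (starRingEnd ℂ) hs
  simp only [map_add] at hs'
  -- For unit numbers with product one, each pairwise product is the conjugate of the third, so the
  -- second symmetric function is the conjugate of the first. All coefficients of the cubic with
  -- these roots therefore agree.
  have he2 : a₀ * a₁ + a₀ * a₂ + a₁ * a₂ = b₀ * b₁ + b₀ * b₂ + b₁ * b₂ := by
    have key : ∀ p q s : ℂ, ‖p‖ = 1 → ‖q‖ = 1 → ‖s‖ = 1 → p * q * s = 1 →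
        p * q + p * s + q * s = starRingEnd ℂ p + starRingEnd ℂ q + starRingEnd ℂ s := by
      intro p q s hp hq hs h
      linear_combination (-(p * q)) * hconj s hs -
        (p * s) * hconj q hq - (q * s) * hconj p hp +
        (starRingEnd ℂ p + starRingEnd ℂ q + starRingEnd ℂ s) * h
    rw [key _ _ _ ha₀ ha₁ ha₂ ha, key _ _ _ hb₀ hb₁ hb₂ hb, hs']
  have hpair : ∀ p q s t : ℂ, p + q = s + t → p * q = s * t → (s = p ∧ t = q) ∨ (s = q ∧ t = p) := by
    intro p q s t h1 h2
    have : (s - p) * (s - q) = 0 := by linear_combination (-s) * h1 + h2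
    rcases mul_eq_zero.1 this with h | h
    · left
      have := sub_eq_zero.1 h
      exact ⟨this, by linear_combination -h1 - this⟩
    · right
      have := sub_eq_zero.1 h
      exact ⟨this, by linear_combination -h1 - this⟩
  have hroot : (b₀ - a₀) * ((b₀ - a₁) * (b₀ - a₂)) = 0 := by
    linear_combination (-b₀ ^ 2) * hs + b₀ * he2 - ha + hb
  rcases mul_eq_zero.1 hroot with h | h
  · obtain rfl := sub_eq_zero.1 h
    rcases hpair a₁ a₂ b₁ b₂ (by linear_combination hs)
      (mul_left_cancel₀ (hne _ ha₀) (by linear_combination ha - hb)) with h | h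
    · exact Or.inl ⟨rfl, h.1, h.2⟩
    · exact Or.inr (Or.inl ⟨rfl, h.1, h.2⟩)
  rcases mul_eq_zero.1 h with h | h
  · obtain rfl := sub_eq_zero.1 h
    rcases hpair a₀ a₂ b₁ b₂ (by linear_combination hs)
      (mul_left_cancel₀ (hne _ ha₁) (by linear_combination ha - hb)) with h | h
    · exact Or.inr (Or.inr (Or.inl ⟨rfl, h.1, h.2⟩))
    · exact Or.inr (Or.inr (Or.inr (Or.inl ⟨rfl, h.1, h.2⟩)))
  · obtain rfl := sub_eq_zero.1 h
    rcases hpair a₀ a₁ b₁ b₂ (by linear_combination hs)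
      (mul_left_cancel₀ (hne _ ha₂) (by linear_combination ha - hb)) with h | h
    · exact Or.inr (Or.inr (Or.inr (Or.inr (Or.inl ⟨rfl, h.1, h.2⟩))))
    · exact Or.inr (Or.inr (Or.inr (Or.inr (Or.inr ⟨rfl, h.1, h.2⟩))))

/-- The closed alcove `t₀ ≥ t₁ ≥ t₂ ≥ t₀ - 1` in the plane of vanishing sum contains only one point
of each orbit of the affine Weyl group. -/
theorem alcove_unique {t s : Fin 3 → ℝ} (ht : t 0 + t 1 + t 2 = 0) (hs : s 0 + s 1 + s 2 = 0)
    (ht₀ : t 1 ≤ t 0) (ht₁ : t 2 ≤ t 1) (ht₂ : t 0 - 1 ≤ t 2)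
    (hs₀ : s 1 ≤ s 0) (hs₁ : s 2 ≤ s 1) (hs₂ : s 0 - 1 ≤ s 2)
    (hcos : ∑ i, Real.cos (2 * Real.pi * t i) = ∑ i, Real.cos (2 * Real.pi * s i))
    (hsin : ∑ i, Real.sin (2 * Real.pi * t i) = ∑ i, Real.sin (2 * Real.pi * s i)) :
    s 0 = t 0 ∧ s 1 = t 1 := by
  set e : ℝ → ℂ := fun v => Complex.exp (2 * Real.pi * v * Complex.I) with he
  have hnorm : ∀ v, ‖e v‖ = 1 := fun v => by
    have : e v = Complex.exp ((2 * Real.pi * v : ℝ) * Complex.I) := by simp [he]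
    rw [this, Complex.norm_exp_ofReal_mul_I]
  have hcs : ∀ v, e v = (Real.cos (2 * Real.pi * v) : ℝ) + (Real.sin (2 * Real.pi * v) : ℝ) *
      Complex.I := fun v => by
    have : e v = Complex.exp ((2 * Real.pi * v : ℝ) * Complex.I) := by simp [he]
    rw [this, Complex.exp_mul_I, Complex.ofReal_cos, Complex.ofReal_sin]
  have hprod : ∀ w : Fin 3 → ℝ, w 0 + w 1 + w 2 = 0 → e (w 0) * e (w 1) * e (w 2) = 1 := by
    intro w hw
    simp only [he]
    rw [← Complex.exp_add, ← Complex.exp_add, Complex.exp_eq_one_iff]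
    refine ⟨0, ?_⟩
    have hw' : (w 0 : ℂ) + w 1 + w 2 = 0 := by exact_mod_cast hw
    linear_combination (2 * Real.pi * Complex.I) * hw'
  have hsum : e (t 0) + e (t 1) + e (t 2) = e (s 0) + e (s 1) + e (s 2) := by
    rw [Fin.sum_univ_three, Fin.sum_univ_three] at hcos hsin
    have hcos' := congrArg (fun v : ℝ => (v : ℂ)) hcos
    have hsin' := congrArg (fun v : ℝ => (v : ℂ)) hsin
    simp only [Complex.ofReal_add] at hcos' hsin'
    simp only [hcs]
    linear_combination hcos' + Complex.I * hsin'
  have hint : ∀ v w : ℝ, e v = e w → ∃ m : ℤ, v = w + m := by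
    intro v w h
    obtain ⟨m, hm⟩ := Complex.exp_eq_exp_iff_exists_int.1 h
    refine ⟨m, ?_⟩
    have h2 : (2 * Real.pi * Complex.I : ℂ) ≠ 0 := Complex.two_pi_I_ne_zero
    have h3 : (v : ℂ) = w + m := by
      apply mul_left_cancel₀ h2
      linear_combination hm
    exact_mod_cast h3
  -- Equal exponentials mean equality modulo `1`. Alcove coordinates lie in `[-2/3, 2/3]`, so each
  -- shift is `-1`, `0` or `1`, and finitely many linear cases remain.
  have hfin : ∀ {p q w : ℝ}, p + q + w = 0 → e (s 0) = e p ∧ e (s 1) = e q ∧ e (s 2) = e w →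
      -2 / 3 ≤ p → p ≤ 2 / 3 → -2 / 3 ≤ q → q ≤ 2 / 3 →
      ∃ m₀ m₁ : ℤ, -1 ≤ m₀ ∧ m₀ ≤ 1 ∧ -1 ≤ m₁ ∧ m₁ ≤ 1 ∧ s 0 = p + m₀ ∧ s 1 = q + m₁ ∧
        s 2 = w - m₀ - m₁ := by
    rintro p q w hpq ⟨h0, h1, -⟩ a1 a2 a3 a4
    obtain ⟨m₀, hm₀⟩ := hint _ _ h0
    obtain ⟨m₁, hm₁⟩ := hint _ _ h1
    have b1 : (-2 : ℝ) < m₀ := by linarith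
    have b2 : (m₀ : ℝ) < 2 := by linarith
    have b3 : (-2 : ℝ) < m₁ := by linarith
    have b4 : (m₁ : ℝ) < 2 := by linarith
    refine ⟨m₀, m₁, ?_, ?_, ?_, ?_, hm₀, hm₁, by linarith⟩
    · have : -2 < m₀ := by exact_mod_cast b1
      omega
    · have : m₀ < 2 := by exact_mod_cast b2
      omega
    · have : -2 < m₁ := by exact_mod_cast b3
      omega
    · have : m₁ < 2 := by exact_mod_cast b4
      omega
  rcases unit_triple_eq (hnorm _) (hnorm _) (hnorm _) (hnorm _) (hnorm _) (hnorm _) (hprod t ht)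
    (hprod s hs) hsum with h | h | h | h | h | h <;>
  obtain ⟨m₀, m₁, a1, a2, a3, a4, e0, e1, e2⟩ := hfin (by linarith) h (by linarith) (by linarith)
    (by linarith) (by linarith) <;>
  interval_cases m₀ <;> interval_cases m₁ <;> norm_num at e0 e1 e2 <;>
  constructor <;> linarith

end Alcove

section Triangle

open Equiv (Perm)

variable {n : Fin 3 → Plane} {b : Fin 3 → ℝ} {h : ℝ}

/-- Coordinates in which an equilateral triangle is the alcove `t₀ ≥ t₁ ≥ t₂ ≥ t₀ - 1`. -/
noncomputable def alcoveCoord (n : Fin 3 → Plane) (b : Fin 3 → ℝ) (h : ℝ) (i : Fin 3) (x : Plane) :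
    ℝ :=
  -- When the gaps sum to `3h`, the three differences `t₀ - t₁`, `t₁ - t₂` and `t₂ - t₀ + 1` are the
  -- gaps divided by `3h`.
  ![(gap n b 0 x - gap n b 2 x + 3 * h) / (9 * h), (gap n b 1 x - gap n b 0 x) / (9 * h),
    (gap n b 2 x - gap n b 1 x - 3 * h) / (9 * h)] i

/-- The gradients of the coordinates `alcoveCoord`. -/
noncomputable def alcoveGrad (n : Fin 3 → Plane) (h : ℝ) (i : Fin 3) : Plane :=
  (9 * h)⁻¹ • ![n 2 - n 0, n 0 - n 1, n 1 - n 2] i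

theorem alcoveCoord_eq (n : Fin 3 → Plane) (b : Fin 3 → ℝ) (h : ℝ) (i : Fin 3) (x : Plane) :
    alcoveCoord n b h i x = inner ℝ (alcoveGrad n h i) x + alcoveCoord n b h i 0 := by
  fin_cases i <;>
  · simp only [alcoveCoord, alcoveGrad, gap, real_inner_smul_left, Fin.zero_eta, Fin.mk_one,
      Fin.reduceFinMk, Matrix.cons_val, inner_sub_left, inner_zero_right]
    ring

theorem alcoveCoord_sum (n : Fin 3 → Plane) (b : Fin 3 → ℝ) (h : ℝ) (x : Plane) :
    ∑ i, alcoveCoord n b h i x = 0 := by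
  simp only [alcoveCoord, Fin.sum_univ_three, Matrix.cons_val]
  ring

theorem continuous_alcoveCoord (n : Fin 3 → Plane) (b : Fin 3 → ℝ) (h : ℝ) (i : Fin 3) :
    Continuous (alcoveCoord n b h i) := by
  rw [funext (alcoveCoord_eq n b h i)]
  fun_prop

/-- The phase of a plane wave in the alcove coordinates. -/
noncomputable def wavePhase (n : Fin 3 → Plane) (b : Fin 3 → ℝ) (h : ℝ) (m : Fin 3 → ℤ)
    (σ : Perm (Fin 3)) (x : Plane) : ℝ :=
  2 * Real.pi * ∑ i, m i * alcoveCoord n b h (σ i) x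

/-- Lamé's eigenfunctions of the equilateral triangle. -/
noncomputable def triangleWave (n : Fin 3 → Plane) (b : Fin 3 → ℝ) (h : ℝ) (m : Fin 3 → ℤ)
    (δ : ℝ) : C(Plane, ℝ) :=
  ⟨fun x => ∑ σ : Perm (Fin 3), Real.cos (wavePhase n b h m σ x + δ), by
    have := continuous_alcoveCoord n b h
    unfold wavePhase
    fun_prop⟩

theorem triangleWave_apply (m : Fin 3 → ℤ) (δ : ℝ) (x : Plane) : triangleWave n b h m δ x =
    ∑ σ : Perm (Fin 3), Real.cos (wavePhase n b h m σ x + δ) := rfl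

/-- Up to scale, this is the Gram matrix of the standard basis of `ℝ³` projected to the plane of
vanishing sum. -/
theorem inner_alcoveGrad (hh : h ≠ 0) (hn : ∀ k, ‖n k‖ = 1)
    (hij : ∀ i j, i ≠ j → inner ℝ (n i) (n j) = -1 / 2) (i j : Fin 3) :
    inner ℝ (alcoveGrad n h i) (alcoveGrad n h j) =
      (18 * h ^ 2)⁻¹ * ((if i = j then 1 else 0) - 1 / 3) := by
  have hnn : ∀ k, inner ℝ (n k) (n k) = 1 := fun k => by
    rw [real_inner_self_eq_norm_sq, hn]; norm_num
  have h01 := hij 0 1 (by decide)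
  have h02 := hij 0 2 (by decide)
  have h12 := hij 1 2 (by decide)
  have h10 := hij 1 0 (by decide)
  have h20 := hij 2 0 (by decide)
  have h21 := hij 2 1 (by decide)
  fin_cases i <;> fin_cases j <;>
  · simp only [alcoveGrad, Fin.zero_eta, Fin.mk_one, Fin.reduceFinMk, Matrix.cons_val,
      real_inner_smul_left, inner_smul_right, inner_sub_left, inner_sub_right, hnn, h01, h02, h12,
      h10, h20, h21]
    simp
    field_simp
    norm_num

theorem norm_sum_alcoveGrad_sq (hh : h ≠ 0) (hn : ∀ k, ‖n k‖ = 1)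
    (hij : ∀ i j, i ≠ j → inner ℝ (n i) (n j) = -1 / 2) (m : Fin 3 → ℤ) (σ : Perm (Fin 3)) :
    ‖∑ i, (m i : ℝ) • alcoveGrad n h (σ i)‖ ^ 2 =
      (18 * h ^ 2)⁻¹ * (∑ i, (m i : ℝ) ^ 2 - (∑ i, (m i : ℝ)) ^ 2 / 3) := by
  rw [← real_inner_self_eq_norm_sq]
  simp only [sum_inner, inner_sum, real_inner_smul_left, inner_smul_right,
    inner_alcoveGrad hh hn hij, EmbeddingLike.apply_eq_iff_eq]
  simp only [Fin.sum_univ_three]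
  simp
  ring

/-- The permutation of the alcove coordinates effected by the reflection in a side. -/
def reflPerm (k : Fin 3) : Perm (Fin 3) := ![Equiv.swap 0 1, Equiv.swap 1 2, Equiv.swap 0 2] k

/-- The translation of the alcove coordinates effected by the reflection in a side. -/
def reflShift (k : Fin 3) : Fin 3 → ℤ := ![0, 0, ![1, 0, -1]] k

/-- The first two sides are the walls `t₀ = t₁` and `t₁ = t₂`, whose reflections swap coordinates;
the third is the affine wall `t₀ - t₂ = 1`, whose reflection also translates by an integer vector.
-/
theorem alcoveCoord_reflect (hh : h ≠ 0) (hn : ∀ k, ‖n k‖ = 1)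
    (hij : ∀ i j, i ≠ j → inner ℝ (n i) (n j) = -1 / 2)
    (hsum : ∀ x, gap n b 0 x + gap n b 1 x + gap n b 2 x = 3 * h) (k i : Fin 3) (x : Plane) :
    alcoveCoord n b h i (x + (2 * gap n b k x) • n k) =
      alcoveCoord n b h (reflPerm k i) x + reflShift k i := by
  have hnn : ∀ k, inner ℝ (n k) (n k) = 1 := fun k => by
    rw [real_inner_self_eq_norm_sq, hn]; norm_num
  have h01 := hij 0 1 (by decide)
  have h02 := hij 0 2 (by decide)
  have h12 := hij 1 2 (by decide)
  have h10 := hij 1 0 (by decide)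
  have h20 := hij 2 0 (by decide)
  have h21 := hij 2 1 (by decide)
  have hs := hsum x
  have p0 : reflPerm 0 = Equiv.swap 0 1 := rfl
  have p1 : reflPerm 1 = Equiv.swap 1 2 := rfl
  have p2 : reflPerm 2 = Equiv.swap 0 2 := rfl
  have q1 : Equiv.swap (0 : Fin 3) 1 2 = 2 := by decide
  have q2 : Equiv.swap (1 : Fin 3) 2 0 = 0 := by decide
  have q3 : Equiv.swap (0 : Fin 3) 2 1 = 1 := by decide
  have hg : gap n b 2 x = 3 * h - gap n b 0 x - gap n b 1 x := by linarith
  fin_cases k <;> fin_cases i <;>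
  · simp only [alcoveCoord, Fin.zero_eta, Fin.mk_one, Fin.reduceFinMk, Matrix.cons_val, p0, p1, p2,
      Equiv.swap_apply_left, Equiv.swap_apply_right, q1, q2, q3, reflShift, gap_reflect, hnn,
      h01, h02, h12, h10, h20, h21]
    simp only [hg]
    simp
    try field_simp
    try ring

/-- A reflection permutes the summands and shifts each phase by an integer multiple of `2π`, because
the frequencies `m` are integers. -/
theorem isNeumannEigenpair_triangleWave (hb : Bornology.IsBounded (openPolygon n b)) (hh : h ≠ 0)
    (hn : ∀ k, ‖n k‖ = 1) (hij : ∀ i j, i ≠ j → inner ℝ (n i) (n j) = -1 / 2)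
    (hsum : ∀ x, gap n b 0 x + gap n b 1 x + gap n b 2 x = 3 * h) (m : Fin 3 → ℤ) (δ : ℝ) :
    ∃ F, IsNeumannEigenpair (openPolygon n b) (triangleWave n b h m δ) F
      (4 * Real.pi ^ 2 * ((18 * h ^ 2)⁻¹ * (∑ i, (m i : ℝ) ^ 2 - (∑ i, (m i : ℝ)) ^ 2 / 3))) := by
  refine ⟨_, isNeumannEigenpair_wave hb hn (J := Perm (Fin 3)) (fun _ => 1)
    (fun σ => 2 * Real.pi * ∑ i, m i * alcoveCoord n b h (σ i) 0 + δ)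
    (fun σ => (2 * Real.pi) • ∑ i, (m i : ℝ) • alcoveGrad n h (σ i)) _ ?_ ?_ ?_⟩
  · intro σ
    rw [norm_smul, mul_pow, norm_sum_alcoveGrad_sq hh hn hij, Real.norm_eq_abs, sq_abs]
    ring
  · intro x
    rw [triangleWave_apply]
    refine Finset.sum_congr rfl fun σ _ => ?_
    rw [one_mul, wavePhase, real_inner_smul_left, sum_inner]
    simp only [real_inner_smul_left]
    rw [← add_assoc, ← mul_add, ← Finset.sum_add_distrib]
    congr 3
    refine Finset.sum_congr rfl fun i _ => ?_
    rw [alcoveCoord_eq]; ring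
  · intro k x
    rw [triangleWave_apply, triangleWave_apply]
    refine Fintype.sum_equiv (Equiv.mulLeft (reflPerm k)) _ _ fun σ => ?_
    have : wavePhase n b h m σ (x + (2 * gap n b k x) • n k) =
        wavePhase n b h m (reflPerm k * σ) x +
          (∑ i, m i * reflShift k (σ i) : ℤ) * (2 * Real.pi) := by
      simp only [wavePhase, alcoveCoord_reflect hh hn hij hsum, Perm.mul_apply]
      push_cast
      rw [mul_comm _ (2 * Real.pi), ← mul_add, ← Finset.sum_add_distrib]
      congr 1
      exact Finset.sum_congr rfl fun i _ => by ring
    rw [this, add_right_comm, Real.cos_add_int_mul_two_pi]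
    rfl

theorem wavePhase_mul (m : Fin 3 → ℤ) (σ ρ : Perm (Fin 3)) (x : Plane) :
    wavePhase n b h m (σ * ρ) x = wavePhase n b h (fun i => m (ρ⁻¹ i)) σ x := by
  rw [wavePhase, wavePhase]
  congr 1
  refine Fintype.sum_equiv ρ _ _ fun i => ?_
  simp

theorem wavePhase_add (m l : Fin 3 → ℤ) (σ : Perm (Fin 3)) (x : Plane) :
    wavePhase n b h (m + l) σ x = wavePhase n b h m σ x + wavePhase n b h l σ x := by
  simp only [wavePhase, ← mul_add, ← Finset.sum_add_distrib]
  congr 1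
  exact Finset.sum_congr rfl fun i _ => by simp; ring

theorem wavePhase_sub (m l : Fin 3 → ℤ) (σ : Perm (Fin 3)) (x : Plane) :
    wavePhase n b h (m - l) σ x = wavePhase n b h m σ x - wavePhase n b h l σ x := by
  simp only [wavePhase, ← mul_sub, ← Finset.sum_sub_distrib]
  congr 1
  exact Finset.sum_congr rfl fun i _ => by simp; ring

/-- Product-to-sum for cosines; writing the second permutation as `σ * ρ` collects the double sum
into symmetrised waves indexed by `ρ`. -/
theorem triangleWave_mul (m l : Fin 3 → ℤ) (δ ε : ℝ) :
    triangleWave n b h m δ * triangleWave n b h l ε =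
      ∑ ρ : Perm (Fin 3), (1 / 2 : ℝ) • (triangleWave n b h (m + fun i => l (ρ⁻¹ i)) (δ + ε) +
        triangleWave n b h (m - fun i => l (ρ⁻¹ i)) (δ - ε)) := by
  ext x
  simp only [ContinuousMap.mul_apply, ContinuousMap.sum_apply, ContinuousMap.smul_apply,
    ContinuousMap.add_apply, triangleWave_apply, smul_eq_mul]
  rw [Finset.sum_mul_sum]
  simp only [← Finset.sum_add_distrib, Finset.mul_sum]
  rw [Finset.sum_comm (s := Finset.univ) (t := Finset.univ)
    (f := fun ρ σ : Perm (Fin 3) => 1 / 2 * (Real.cos (wavePhase n b h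
      (m + fun i => l (ρ⁻¹ i)) σ x + (δ + ε)) + Real.cos (wavePhase n b h
      (m - fun i => l (ρ⁻¹ i)) σ x + (δ - ε))))]
  refine Finset.sum_congr rfl fun σ _ => ?_
  refine (Fintype.sum_equiv (Equiv.mulLeft σ) _ _ fun ρ => ?_).symm
  rw [Equiv.coe_mulLeft, wavePhase_mul, wavePhase_add, wavePhase_sub]
  rw [show wavePhase n b h m σ x + wavePhase n b h (fun i => l (ρ⁻¹ i)) σ x + (δ + ε) =
      (wavePhase n b h m σ x + δ) + (wavePhase n b h (fun i => l (ρ⁻¹ i)) σ x + ε) by ring,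
    show wavePhase n b h m σ x - wavePhase n b h (fun i => l (ρ⁻¹ i)) σ x + (δ - ε) =
      (wavePhase n b h m σ x + δ) - (wavePhase n b h (fun i => l (ρ⁻¹ i)) σ x + ε) by ring,
    Real.cos_add, Real.cos_sub]
  ring

/-- Each value of `σ 0` is taken by exactly two permutations. -/
theorem sum_perm_fin_three_apply_zero (f : Fin 3 → ℝ) :
    ∑ σ : Perm (Fin 3), f (σ 0) = 2 * ∑ i, f i := by
  rw [← Fintype.sum_equiv (Equiv.Perm.decomposeFin (n := 2)).symm
    (fun p => f p.1) _ fun p => by rw [← Prod.mk.eta (p := p), Perm.decomposeFin_symm_apply_zero]]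
  rw [Fintype.sum_prod_type, Finset.mul_sum]
  simp [Fintype.card_perm]

theorem triangleWave_single (δ : ℝ) (x : Plane) : triangleWave n b h ![1, 0, 0] δ x =
    2 * ∑ i, Real.cos (2 * Real.pi * alcoveCoord n b h i x + δ) := by
  rw [triangleWave_apply, ← sum_perm_fin_three_apply_zero]
  refine Finset.sum_congr rfl fun σ _ => ?_
  simp [wavePhase, Fin.sum_univ_three]

theorem neumannMu1_triangle (hb : Bornology.IsBounded (openPolygon n b)) (hh : 0 < h)
    (hn : ∀ k, ‖n k‖ = 1) (hij : ∀ i j, i ≠ j → inner ℝ (n i) (n j) = -1 / 2)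
    (hn0 : n 0 + n 1 + n 2 = 0) (c : Plane) (hc : ∀ k, b k = h + inner ℝ (n k) c)
    (hinj : ∀ z, inner ℝ (n 0) z = 0 → inner ℝ (n 1) z = 0 → z = 0) :
    neumannMu1 (openPolygon n b) = 4 * Real.pi ^ 2 / (27 * h ^ 2) := by
  have ho := isOpen_openPolygon n b
  have hpi := Real.pi_pos
  have hμ : 0 < 4 * Real.pi ^ 2 / (27 * h ^ 2) := by positivity
  have hsum : ∀ x, gap n b 0 x + gap n b 1 x + gap n b 2 x = 3 * h := by
    intro x
    have e : ∀ y, inner ℝ (n 0) y + inner ℝ (n 1) y + inner ℝ (n 2) y = 0 := fun y => by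
      rw [← inner_add_left, ← inner_add_left, hn0, inner_zero_left]
    have e1 := e x
    have e2 := e c
    simp only [gap, hc]
    linarith
  have heig := isNeumannEigenpair_triangleWave hb hh.ne' hn hij hsum
  set E : Set C(Plane, ℝ) :=
    Set.range fun i : (Fin 3 → ℤ) × ℝ => triangleWave n b h i.1 i.2 with hE
  have hmem : ∀ m δ, triangleWave n b h m δ ∈ Submodule.span ℝ E := fun m δ =>
    Submodule.subset_span ⟨(m, δ), rfl⟩
  obtain ⟨F, hF⟩ := heig ![1, 0, 0] 0
  -- The centre will not do as the point of nonvanishing: there the coordinates are `1/3, 0, -1/3`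
  -- and the wave is zero.
  have hgap : ∀ k, gap n b k (c - (h / 2) • n 0) = h + h / 2 * inner ℝ (n k) (n 0) := fun k => by
    rw [gap, hc, inner_sub_right, inner_smul_right]; ring
  have g0 : gap n b 0 (c - (h / 2) • n 0) = 3 / 2 * h := by
    rw [hgap, real_inner_self_eq_norm_sq, hn]; ring
  have g1 : gap n b 1 (c - (h / 2) • n 0) = 3 / 4 * h := by
    rw [hgap, hij 1 0 (by decide)]; ring
  have g2 : gap n b 2 (c - (h / 2) • n 0) = 3 / 4 * h := by
    rw [hgap, hij 2 0 (by decide)]; ring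
  refine neumannMu1_eq ho hb hμ (fun u G hu hu0 => ?_) (φ := triangleWave n b h ![1, 0, 0] 0)
    (F := F) ?_ (x₀ := c - (h / 2) • n 0) ?_ ?_
  · refine poincare_of_eigenfunctions hb ho.measurableSet hμ E ?_ ?_ ?_ ?_ hu hu0
    · rintro _ ⟨⟨m, δ⟩, rfl⟩
      obtain ⟨H, hH⟩ := heig m δ
      refine ⟨H, _, hH, ?_⟩
      by_cases h0 : m 0 = m 1 ∧ m 1 = m 2
      · left
        refine ⟨?_, ∑ σ : Perm (Fin 3), Real.cos δ, fun x _ => ?_⟩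
        · simp only [Fin.sum_univ_three, h0.1, h0.2]; ring
        · rw [triangleWave_apply]
          refine Finset.sum_congr rfl fun σ _ => ?_
          have hm : ∀ i, m i = m 2 := fun i => by
            fin_cases i
            · exact h0.1.trans h0.2
            · exact h0.2
            · rfl
          rw [wavePhase]
          simp only [hm]
          rw [← Finset.mul_sum, Equiv.sum_comp σ (fun i => alcoveCoord n b h i x),
            alcoveCoord_sum]
          simp
      · right
        -- The form is twice a positive definite integral form in the differences of the `m i`, so
        -- it is at least `2` off the constants; this is the spectral gap.
        have key : 2 ≤ 3 * (m 0 ^ 2 + m 1 ^ 2 + m 2 ^ 2) - (m 0 + m 1 + m 2) ^ 2 := by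
          have e : 3 * (m 0 ^ 2 + m 1 ^ 2 + m 2 ^ 2) - (m 0 + m 1 + m 2) ^ 2 =
            2 * ((m 0 - m 1) ^ 2 + (m 1 - m 2) ^ 2 + (m 0 - m 1) * (m 1 - m 2)) := by ring
          rw [e]
          have h1 : 0 < (m 0 - m 1) ^ 2 + (m 1 - m 2) ^ 2 + (m 0 - m 1) * (m 1 - m 2) := by
            by_cases h01 : m 0 = m 1
            · have : m 1 - m 2 ≠ 0 := fun h2 => h0 ⟨h01, by linarith⟩
              rw [h01, sub_self]
              have := sq_pos_of_ne_zero this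
              linarith
            · have := sq_pos_of_ne_zero (sub_ne_zero.2 h01)
              nlinarith [sq_nonneg ((m 0 - m 1) + 2 * (m 1 - m 2))]
          omega
        have key' : (2 : ℝ) ≤ 3 * ((m 0 : ℝ) ^ 2 + (m 1 : ℝ) ^ 2 + (m 2 : ℝ) ^ 2) -
            ((m 0 : ℝ) + m 1 + m 2) ^ 2 := by exact_mod_cast key
        simp only [Fin.sum_univ_three]
        rw [show 4 * Real.pi ^ 2 / (27 * h ^ 2) =
          4 * Real.pi ^ 2 * ((18 * h ^ 2)⁻¹ * (2 / 3)) by field_simp; norm_num]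
        gcongr
        linarith
    · have : (1 : C(Plane, ℝ)) = (1 / 6 : ℝ) • triangleWave n b h 0 0 := by
        ext x
        simp [triangleWave_apply, wavePhase, Fintype.card_perm, Nat.factorial]
      rw [this]
      exact Submodule.smul_mem _ _ (hmem _ _)
    · rintro _ ⟨⟨m, δ⟩, rfl⟩ _ ⟨⟨l, ε⟩, rfl⟩
      simp only [triangleWave_mul]
      exact Submodule.sum_mem _ fun ρ _ => Submodule.smul_mem _ _
        (Submodule.add_mem _ (hmem _ _) (hmem _ _))
    · intro x hx y hy hxy
      by_contra hcon
      push Not at hcon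
      -- The phases `0` and `-π/2` give the sums of cosines and of sines, that is, the complex sum
      -- of the three exponentials, which determines the point of the alcove.
      have e0 := hcon _ ⟨(![1, 0, 0], 0), rfl⟩
      have e1 := hcon _ ⟨(![1, 0, 0], -(Real.pi / 2)), rfl⟩
      simp only [triangleWave_single, add_zero, ← sub_eq_add_neg, Real.cos_sub_pi_div_two] at e0 e1
      have hA : ∀ z ∈ closure (openPolygon n b), alcoveCoord n b h 0 z + alcoveCoord n b h 1 z +
          alcoveCoord n b h 2 z = 0 ∧ alcoveCoord n b h 1 z ≤ alcoveCoord n b h 0 z ∧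
          alcoveCoord n b h 2 z ≤ alcoveCoord n b h 1 z ∧
          alcoveCoord n b h 0 z - 1 ≤ alcoveCoord n b h 2 z := by
        intro z hz
        have z0 := closure_openPolygon_subset n b hz 0
        have z1 := closure_openPolygon_subset n b hz 1
        have z2 := closure_openPolygon_subset n b hz 2
        have zs := hsum z
        have h3 := alcoveCoord_sum n b h z
        rw [Fin.sum_univ_three] at h3
        refine ⟨h3, ?_, ?_, ?_⟩
        · simp only [alcoveCoord, Matrix.cons_val]
          gcongr ?_ / _
          linarith
        · simp only [alcoveCoord, Matrix.cons_val]
          gcongr ?_ / _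
          linarith
        · simp only [alcoveCoord, Matrix.cons_val]
          rw [div_sub_one (by positivity)]
          gcongr ?_ / _
          linarith
      obtain ⟨x0, x1, x2, x3⟩ := hA x hx
      obtain ⟨y0, y1, y2, y3⟩ := hA y hy
      obtain ⟨r0, r1⟩ := alcove_unique (t := fun i => alcoveCoord n b h i x)
        (s := fun i => alcoveCoord n b h i y) x0 y0 x1 x2 x3 y1 y2 y3
        (mul_left_cancel₀ two_ne_zero e0) (mul_left_cancel₀ two_ne_zero e1)
      have sx := hsum x
      have sy := hsum y
      simp only [alcoveCoord, Matrix.cons_val] at r0 r1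
      field_simp at r0 r1
      simp only [gap] at sx sy r0 r1
      refine hxy (sub_eq_zero.1 (hinj _ ?_ ?_))
      · rw [inner_sub_right]; linarith
      · rw [inner_sub_right]; linarith
  · convert hF using 1
    simp [Fin.sum_univ_three]
    field_simp
    norm_num
  · intro k
    fin_cases k
    · simp only [Fin.zero_eta, g0]; positivity
    · simp only [Fin.mk_one, g1]; positivity
    · simp only [Fin.reduceFinMk, g2]; positivity
  · rw [triangleWave_single, Fin.sum_univ_three]
    simp only [alcoveCoord, Matrix.cons_val, g0, g1, g2, add_zero]
    rw [show 2 * Real.pi * ((3 / 2 * h - 3 / 4 * h + 3 * h) / (9 * h)) =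
        Real.pi - Real.pi / 6 by field_simp; norm_num,
      show 2 * Real.pi * ((3 / 4 * h - 3 / 2 * h) / (9 * h)) = -(Real.pi / 6) by
        field_simp; norm_num,
      show 2 * Real.pi * ((3 / 4 * h - 3 / 4 * h - 3 * h) / (9 * h)) = -(Real.pi - Real.pi / 3) by
        field_simp; norm_num,
      Real.cos_pi_sub, Real.cos_neg, Real.cos_neg, Real.cos_pi_sub, Real.cos_pi_div_three]
    norm_num

end Triangle


/-! ### Radial moments of the regular polygon -/

section Moments

variable {N : ℕ} {c : Plane} {r α : ℝ}

theorem repr_polarCoord_symm (p : ℝ × ℝ) :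
    Complex.orthonormalBasisOneI.repr (Complex.polarCoord.symm p) = p.1 • dir p.2 := by
  ext i
  rw [Complex.orthonormalBasisOneI_repr_apply, Complex.polarCoord_symm_apply]
  fin_cases i <;> simp [dir, -Complex.ofReal_cos, -Complex.ofReal_sin]

/-- Integration over the plane in polar coordinates. -/
theorem integral_eq_integral_polar (f : Plane → ℝ) (c : Plane) : ∫ x, f x =
    ∫ p in Set.Ioi (0 : ℝ) ×ˢ Set.Ioo (-Real.pi) Real.pi, p.1 * f (c + p.1 • dir p.2) := by
  rw [← integral_add_left_eq_self f c,
    ← (Complex.orthonormalBasisOneI.repr.measurePreserving).integral_comp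
      (Complex.orthonormalBasisOneI.repr.toHomeomorph.measurableEmbedding),
    ← Complex.integral_comp_polarCoord_symm, polarCoord_target]
  simp only [repr_polarCoord_symm, smul_eq_mul]

theorem continuous_dir : Continuous dir :=
  (PiLp.continuous_toLp 2 _).comp (continuous_pi fun i => by
    fin_cases i
    · exact Real.continuous_cos
    · exact Real.continuous_sin)

theorem inner_outerNormal_dir_shift (hN : 0 < N) (k : ℤ) (θ : ℝ) :
    inner ℝ (outerNormal N α k) (dir (θ + 2 * Real.pi / N)) =
      inner ℝ (outerNormal N α (k - 1)) (dir θ) := by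
  rw [outerNormal, outerNormal, inner_dir, inner_dir]
  congr 1
  have : (N : ℝ) ≠ 0 := by positivity
  push_cast
  field_simp
  ring

theorem mem_regPolygon_polar_periodic (hN : 0 < N) (ρ θ : ℝ) :
    c + ρ • dir (θ + 2 * Real.pi / N) ∈ regPolygon N c r α ↔
      c + ρ • dir θ ∈ regPolygon N c r α := by
  simp only [mem_regPolygon hN, add_sub_cancel_left, inner_smul_right,
    inner_outerNormal_dir_shift hN]
  constructor
  · intro h k
    simpa using h (k + 1)
  · exact fun h k => h (k - 1)

/-- The regular polygon in polar coordinates, in the sector belonging to one side. -/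
theorem mem_regPolygon_polar (hN : 3 ≤ N) (hr : 0 < r) {ρ φ : ℝ} (hρ : 0 ≤ ρ)
    (hφ : φ ∈ Set.Icc (-(Real.pi / N)) (Real.pi / N)) :
    c + ρ • dir (α + Real.pi / N + φ) ∈ regPolygon N c r α ↔
      ρ * Real.cos φ < r * Real.cos (Real.pi / N) := by
  have hN0 : 0 < N := by omega
  have hN' : (0 : ℝ) < N := by positivity
  have hN3 : (3 : ℝ) ≤ N := by exact_mod_cast hN
  have hpi := Real.pi_pos
  set x := Real.pi / N with hx
  have hx0 : 0 < x := by positivity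
  have hxpi : 2 * x < Real.pi := by
    rw [hx, ← mul_div_assoc, div_lt_iff₀ hN']; nlinarith
  have hs : 0 < Real.sin (2 * x) := Real.sin_pos_of_pos_of_lt_pi (by linarith) hxpi
  have h1 := Real.sin_nonneg_of_nonneg_of_le_pi (x := x + φ) (by linarith [hφ.1])
    (by linarith [hφ.2])
  have h2 := Real.sin_nonneg_of_nonneg_of_le_pi (x := 2 * x - (x + φ)) (by linarith [hφ.2])
    (by linarith [hφ.1])
  have key := sin_smul_dir α (x + φ) (2 * x)
  set a := ρ * Real.sin (2 * x - (x + φ)) / (r * Real.sin (2 * x)) with ha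
  set b := ρ * Real.sin (x + φ) / (r * Real.sin (2 * x)) with hb
  have ha0 : 0 ≤ a := by positivity
  have hb0 : 0 ≤ b := by positivity
  have hcone : ρ • dir (α + x + φ) = a • spoke N r α 0 + b • spoke N r α (0 + 1) := by
    have e4 : dir (α + x + φ) = (Real.sin (2 * x))⁻¹ • (Real.sin (2 * x) • dir (α + (x + φ))) := by
      rw [smul_smul, inv_mul_cancel₀ hs.ne', one_smul, add_assoc]
    rw [e4, key, spoke, spoke]
    simp only [smul_add, smul_smul]
    have e1 : α + 2 * Real.pi * ((0 : ℤ) : ℝ) / N = α := by simp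
    have e2 : α + 2 * Real.pi * ((0 + 1 : ℤ) : ℝ) / N = α + 2 * x := by
      rw [hx]; push_cast; ring
    rw [e1, e2, ha, hb]
    congr 2 <;> field_simp
  have h0 : inner ℝ (outerNormal N α 0) (ρ • dir (α + x + φ)) = ρ * Real.cos φ := by
    rw [inner_smul_right, outerNormal, inner_dir,
      show α + (2 * ((0 : ℤ) : ℝ) + 1) * Real.pi / N - (α + x + φ) = -φ by rw [hx]; simp,
      Real.cos_neg]
  rw [mem_regPolygon hN0]
  constructor
  · intro h
    have := h 0
    rwa [add_sub_cancel_left, h0] at this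
  · intro h k
    rw [add_sub_cancel_left, hcone]
    refine (inner_cone_le hN0 hr ha0 hb0 k 0).trans_lt ?_
    rwa [← inner_cone_self hN0, ← hcone, h0]

/-- In polar coordinates the radial integral is `2π/N`-periodic in the angle, so one sector centred
at an outer normal suffices; there the polygon is `ρ cos φ < h`, with `h` the inradius. -/
theorem setIntegral_regPolygon_pow (hN : 3 ≤ N) (hr : 0 < r) (k : ℕ) :
    ∫ x in regPolygon N c r α, (‖x - c‖ ^ 2) ^ k =
      N * ∫ φ in (-(Real.pi / N))..(Real.pi / N),
        (r * Real.cos (Real.pi / N) / Real.cos φ) ^ (2 * k + 2) / (2 * k + 2) := by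
  have hN0 : 0 < N := by omega
  have hN' : (0 : ℝ) < N := by positivity
  have hN3 : (3 : ℝ) ≤ N := by exact_mod_cast hN
  have hpi := Real.pi_pos
  have hh := inradius_pos hN hr
  have ho : IsOpen (regPolygon N c r α) := isOpen_openPolygon _ _
  have hx0 : 0 < Real.pi / N := by positivity
  have hx2 : Real.pi / N < Real.pi / 2 := by
    rw [div_lt_div_iff₀ hN' two_pos]; nlinarith
  set A : Set (ℝ × ℝ) := {p | c + p.1 • dir p.2 ∈ regPolygon N c r α} with hA
  have hAo : IsOpen A := ho.preimage (continuous_const.add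
    (continuous_fst.smul (continuous_dir.comp continuous_snd)))
  set f : ℝ × ℝ → ℝ := A.indicator fun p => p.1 ^ (2 * k + 1) with hf
  have hpolar : ∫ x in regPolygon N c r α, (‖x - c‖ ^ 2) ^ k =
      ∫ p in Set.Ioi (0 : ℝ) ×ˢ Set.Ioo (-Real.pi) Real.pi, f p := by
    rw [← integral_indicator ho.measurableSet, integral_eq_integral_polar _ c]
    refine integral_congr_ae (Filter.Eventually.of_forall fun p => ?_)
    by_cases hp : p ∈ A
    · have hp' : c + p.1 • dir p.2 ∈ regPolygon N c r α := hp
      simp only [hf, Set.indicator_of_mem hp, Set.indicator_of_mem hp', add_sub_cancel_left,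
        norm_smul, norm_dir, mul_one, Real.norm_eq_abs, sq_abs]
      ring
    · have hp' : c + p.1 • dir p.2 ∉ regPolygon N c r α := hp
      simp only [hf, Set.indicator_of_notMem hp, Set.indicator_of_notMem hp', mul_zero]
  have hfi : Integrable f ((volume.restrict (Set.Ioi (0 : ℝ))).prod
      (volume.restrict (Set.Ioo (-Real.pi) Real.pi))) := by
    rw [Measure.prod_restrict, integrable_indicator_iff hAo.measurableSet, IntegrableOn,
      Measure.restrict_restrict hAo.measurableSet]
    obtain ⟨R, hR⟩ := (isBounded_regPolygon (c := c) (α := α) hN hr).subset_ball c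
    have hsub : A ∩ Set.Ioi (0 : ℝ) ×ˢ Set.Ioo (-Real.pi) Real.pi ⊆
        Set.Icc 0 R ×ˢ Set.Icc (-Real.pi) Real.pi := by
      rintro ⟨ρ, θ⟩ ⟨hp, hρ, hθ⟩
      have := hR hp
      rw [mem_ball_iff_norm, add_sub_cancel_left, norm_smul, norm_dir, mul_one, Real.norm_eq_abs,
        abs_of_pos hρ] at this
      exact ⟨⟨le_of_lt hρ, this.le⟩, ⟨hθ.1.le, hθ.2.le⟩⟩
    have hc : ContinuousOn (fun p : ℝ × ℝ => p.1 ^ (2 * k + 1))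
      (Set.Icc 0 R ×ˢ Set.Icc (-Real.pi) Real.pi) := (continuous_fst.pow _).continuousOn
    exact (hc.integrableOn_compact (isCompact_Icc.prod isCompact_Icc)).mono_set hsub
  set W : ℝ → ℝ := fun θ => ∫ ρ in Set.Ioi (0 : ℝ), f (ρ, θ) with hW
  have hiter : ∫ p in Set.Ioi (0 : ℝ) ×ˢ Set.Ioo (-Real.pi) Real.pi, f p =
      ∫ θ in (-Real.pi)..Real.pi, W θ := by
    rw [intervalIntegral.integral_of_le (by linarith), integral_Ioc_eq_integral_Ioo,
      Measure.volume_eq_prod, ← Measure.prod_restrict, integral_prod_symm _ hfi]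
  have hper : Function.Periodic W (2 * Real.pi / N) := by
    intro θ
    refine integral_congr_ae (Filter.Eventually.of_forall fun ρ => ?_)
    have : (ρ, θ + 2 * Real.pi / N) ∈ A ↔ (ρ, θ) ∈ A := mem_regPolygon_polar_periodic hN0 ρ θ
    by_cases hp : (ρ, θ) ∈ A
    · simp only [hf, Set.indicator_of_mem hp, Set.indicator_of_mem (this.2 hp)]
    · simp only [hf, Set.indicator_of_notMem hp, Set.indicator_of_notMem (mt this.1 hp)]
  have hper2 : Function.Periodic W (2 * Real.pi) := by
    have := hper.nat_mul N
    rwa [mul_div_cancel₀ _ hN'.ne'] at this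
  have hWval : ∀ φ ∈ Set.Icc (-(Real.pi / N)) (Real.pi / N), W (φ + (α + Real.pi / N)) =
      (r * Real.cos (Real.pi / N) / Real.cos φ) ^ (2 * k + 2) / (2 * k + 2) := by
    intro φ hφ
    have hcos : 0 < Real.cos φ := Real.cos_pos_of_mem_Ioo ⟨by linarith [hφ.1], by linarith [hφ.2]⟩
    have e : ∀ ρ ∈ Set.Ioi (0 : ℝ), f (ρ, φ + (α + Real.pi / N)) =
        (Set.Iio (r * Real.cos (Real.pi / N) / Real.cos φ)).indicator
          (fun ρ => ρ ^ (2 * k + 1)) ρ := by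
      intro ρ hρ
      have hiff : (ρ, φ + (α + Real.pi / N)) ∈ A ↔
          ρ ∈ Set.Iio (r * Real.cos (Real.pi / N) / Real.cos φ) := by
        rw [Set.mem_Iio, lt_div_iff₀ hcos, ← mem_regPolygon_polar hN hr (le_of_lt hρ) hφ, hA,
          add_comm φ]
        rfl
      by_cases hp : (ρ, φ + (α + Real.pi / N)) ∈ A
      · simp only [hf, Set.indicator_of_mem hp, Set.indicator_of_mem (hiff.1 hp)]
      · simp only [hf, Set.indicator_of_notMem hp, Set.indicator_of_notMem (mt hiff.2 hp)]
    simp only [hW]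
    rw [setIntegral_congr_fun measurableSet_Ioi e, setIntegral_indicator measurableSet_Iio,
      Set.Ioi_inter_Iio, ← integral_Ioc_eq_integral_Ioo,
      ← intervalIntegral.integral_of_le (by positivity), integral_pow]
    push_cast
    ring_nf
  have hint : ∫ φ in (-(Real.pi / N))..(Real.pi / N), W (φ + (α + Real.pi / N)) =
      ∫ φ in (-(Real.pi / N))..(Real.pi / N),
        (r * Real.cos (Real.pi / N) / Real.cos φ) ^ (2 * k + 2) / (2 * k + 2) := by
    refine intervalIntegral.integral_congr fun φ hφ => ?_
    rw [Set.uIcc_of_le (by linarith)] at hφ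
    exact hWval φ hφ
  -- Integrability over one period, where `W` is explicit, spreads to all intervals by periodicity.
  have hWi : ∀ a b, IntervalIntegrable W volume a b := by
    have h0 : IntervalIntegrable (fun φ => W (φ + (α + Real.pi / N))) volume
        (-(Real.pi / N)) (Real.pi / N) := by
      have hc : ContinuousOn (fun φ =>
          (r * Real.cos (Real.pi / N) / Real.cos φ) ^ (2 * k + 2) / (2 * k + 2))
          (Set.uIcc (-(Real.pi / N)) (Real.pi / N)) := by
        rw [Set.uIcc_of_le (by linarith)]
        refine ((continuousOn_const.div Real.continuous_cos.continuousOn fun φ hφ => ?_).pow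
          _).div_const _
        exact (Real.cos_pos_of_mem_Ioo ⟨by linarith [hφ.1], by linarith [hφ.2]⟩).ne'
      refine (hc.congr fun φ hφ => ?_).intervalIntegrable
      rw [Set.uIcc_of_le (by linarith)] at hφ
      exact hWval φ hφ
    have h1 := h0.comp_sub_right (α + Real.pi / N)
    simp only [sub_add_cancel] at h1
    refine hper.intervalIntegrable (by positivity) (t := -(Real.pi / N) + (α + Real.pi / N)) ?_
    convert h1 using 1
    ring
  rw [hpolar, hiter, ← hint, intervalIntegral.integral_comp_add_right]
  have h2 := hper2.intervalIntegral_add_eq (-Real.pi) (-(Real.pi / N) + (α + Real.pi / N))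
  have h3 := hper.intervalIntegral_add_zsmul_eq N (-(Real.pi / N) + (α + Real.pi / N)) hWi
  rw [show -Real.pi + 2 * Real.pi = Real.pi by ring] at h2
  rw [show (N : ℤ) • (2 * Real.pi / (N : ℝ)) = 2 * Real.pi by
    rw [zsmul_eq_mul]; push_cast; field_simp,
    show -(Real.pi / N) + (α + Real.pi / N) + 2 * Real.pi / N =
      Real.pi / N + (α + Real.pi / N) by ring] at h3
  rw [h2, h3, zsmul_eq_mul]
  push_cast
  rfl

/-- Moments of the regular polygon, in terms of an antiderivative of `(1 + s ^ 2) ^ k`. -/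
theorem moment_regPolygon (hN : 3 ≤ N) (hr : 0 < r) (k : ℕ) {Q : ℝ → ℝ}
    (hQ : ∀ s, HasDerivAt Q ((1 + s ^ 2) ^ k) s) :
    ∫ x in regPolygon N c r α, (‖x - c‖ ^ 2) ^ k =
      N * ((r * Real.cos (Real.pi / N)) ^ (2 * k + 2) / (2 * k + 2) *
        (Q (Real.tan (Real.pi / N)) - Q (-Real.tan (Real.pi / N)))) := by
  have hN' : (0 : ℝ) < N := by positivity
  have hN3 : (3 : ℝ) ≤ N := by exact_mod_cast hN
  have hpi := Real.pi_pos
  have hx0 : 0 < Real.pi / N := by positivity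
  have hx2 : Real.pi / N < Real.pi / 2 := by
    rw [div_lt_div_iff₀ hN' two_pos]; nlinarith
  rw [setIntegral_regPolygon_pow hN hr, ← Real.tan_neg]
  have hcos : ∀ φ ∈ Set.uIcc (-(Real.pi / N)) (Real.pi / N), Real.cos φ ≠ 0 := by
    intro φ hφ
    rw [Set.uIcc_of_le (by linarith)] at hφ
    exact (Real.cos_pos_of_mem_Ioo ⟨by linarith [hφ.1], by linarith [hφ.2]⟩).ne'
  have hder : ∀ φ ∈ Set.uIcc (-(Real.pi / N)) (Real.pi / N), HasDerivAt
      (fun φ => (r * Real.cos (Real.pi / N)) ^ (2 * k + 2) / (2 * k + 2) * Q (Real.tan φ))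
      ((r * Real.cos (Real.pi / N) / Real.cos φ) ^ (2 * k + 2) / (2 * k + 2)) φ := by
    intro φ hφ
    have hc := hcos φ hφ
    have h1 := ((hQ (Real.tan φ)).comp φ (Real.hasDerivAt_tan hc)).const_mul
      ((r * Real.cos (Real.pi / N)) ^ (2 * k + 2) / (2 * k + 2))
    refine h1.congr_deriv ?_
    -- The substitution `s = tan φ`, with `1 / cos² φ = 1 + s²`.
    have h2 : 1 + Real.tan φ ^ 2 = (Real.cos φ ^ 2)⁻¹ := by
      rw [Real.tan_eq_sin_div_cos]
      field_simp
      linarith [Real.sin_sq_add_cos_sq φ]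
    rw [h2, div_pow, inv_pow, one_div, ← mul_inv, ← pow_succ, ← pow_mul]
    ring
  have hc : ContinuousOn (fun φ =>
      (r * Real.cos (Real.pi / N) / Real.cos φ) ^ (2 * k + 2) / (2 * k + 2))
      (Set.uIcc (-(Real.pi / N)) (Real.pi / N)) :=
    ((continuousOn_const.div Real.continuous_cos.continuousOn hcos).pow _).div_const _
  rw [intervalIntegral.integral_eq_sub_of_hasDerivAt hder hc.intervalIntegrable]
  ring

end Moments


/-! ### Numerical inequalities -/

/-- The derivative of the difference is the geometric remainder `s⁸ / (1 + s²)`. -/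
theorem le_arctan_of_nonneg {t : ℝ} (ht : 0 ≤ t) :
    t - t ^ 3 / 3 + t ^ 5 / 5 - t ^ 7 / 7 ≤ Real.arctan t := by
  have hm : Monotone fun s : ℝ => Real.arctan s - (s - s ^ 3 / 3 + s ^ 5 / 5 - s ^ 7 / 7) := by
    refine monotone_of_hasDerivAt_nonneg (f' := fun s => s ^ 8 / (1 + s ^ 2)) (fun s => ?_)
      fun s => by positivity
    have h := (Real.hasDerivAt_arctan s).sub ((((hasDerivAt_id' s).sub
      ((hasDerivAt_pow 3 s).div_const 3)).add ((hasDerivAt_pow 5 s).div_const 5)).sub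
      ((hasDerivAt_pow 7 s).div_const 7))
    refine h.congr_deriv ?_
    have : 1 + s ^ 2 ≠ 0 := by positivity
    field_simp
    norm_num
    ring
  have := hm ht
  simp only [Real.arctan_zero] at this
  linarith

/-- The worst case is the pentagon, where `tan² (π/5) = 5 - 2√5 ≈ 0.5279`; the bound `66/125 =
0.528` is nearly sharp. -/
theorem tan_sq_pi_div_le {N : ℕ} (hN : 5 ≤ N) : Real.tan (Real.pi / N) ^ 2 ≤ 66 / 125 := by
  have hN' : (5 : ℝ) ≤ N := by exact_mod_cast hN
  have hpi := Real.pi_pos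
  have hle : Real.pi / N ≤ Real.pi / 5 := by gcongr
  have h5 : (2.236 : ℝ) ≤ √5 := Real.le_sqrt_of_sq_le (by norm_num)
  have hc : 0.809 ≤ Real.cos (Real.pi / N) := by
    have h1 := Real.cos_le_cos_of_nonneg_of_le_pi (by positivity : 0 ≤ Real.pi / N)
      (by linarith : Real.pi / 5 ≤ Real.pi) hle
    rw [Real.cos_pi_div_five] at h1
    linarith
  have hc0 : 0 < Real.cos (Real.pi / N) := by linarith
  rw [Real.tan_eq_sin_div_cos, div_pow, div_le_iff₀ (by positivity), Real.sin_sq]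
  nlinarith

/-- The numerical inequality behind the bound for polygons with at least five sides. -/
theorem five_le_polynomial_bound {w : ℝ} (h0 : 0 ≤ w) (h1 : w ≤ 66 / 125) :
    2 - 28 / 25 * (1 + w / 3) + 196 / 750 * (1 + 2 * w / 3 + w ^ 2 / 5) ≤
      4 * (1 - w / 3 + w ^ 2 / 5 - w ^ 3 / 7) ^ 2 *
        ((1 + w / 3) / 2 - 14 / 75 * (1 + 2 * w / 3 + w ^ 2 / 5) +
          49 / 2500 * (1 + w + 3 * w ^ 2 / 5 + w ^ 3 / 7)) := by
  -- The right side minus the left is this cubic plus `w⁴` times the quintic in `hrem`. The cubic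
  -- carries the estimate and is small near `w = 66/125`.
  have hcub : 0 ≤ (119/625) * w ^ 0 + (-2483/5625) * w ^ 1 + (2032/5625) * w ^ 2 + (-624182/1771875) * w ^ 3 := by
    have h2 : 0 ≤ (66 / 125 - w) * w := mul_nonneg (by linarith) h0
    nlinarith [mul_nonneg h2 h0, sq_nonneg (w - 2 / 5)]
  have hrem : 0 ≤ (784/46875) * w ^ 0 + (17524/2953125) * w ^ 1 + (-188798/34453125) * w ^ 2 + (17098/1378125) * w ^ 3 + (-179/65625) * w ^ 4 + (1/4375) * w ^ 5 := by
    have hw1 : w ≤ 1 := by linarith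
    have a2 : w ^ 2 ≤ 1 := pow_le_one₀ h0 hw1
    have a4 : w ^ 4 ≤ 1 := pow_le_one₀ h0 hw1
    have a3 : 0 ≤ w ^ 3 := by positivity
    have a5 : 0 ≤ w ^ 5 := by positivity
    linarith
  have := mul_nonneg (pow_nonneg h0 4) hrem
  nlinarith

/-- With `κ = 7/(25h²)` the powers of `h` in the moments match, so a common factor `N t h²` splits
off both sides of the Rayleigh inequality and leaves polynomials in `t²`. -/
theorem moment_combination_left (N h t M : ℝ) (hh : h ≠ 0) :
    N * t * h ^ 2 * (M * h ^ 2 * ((1 + t ^ 2 / 3) / 2 -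
      14 / 75 * (1 + 2 * t ^ 2 / 3 + (t ^ 2) ^ 2 / 5) +
      49 / 2500 * (1 + t ^ 2 + 3 * (t ^ 2) ^ 2 / 5 + (t ^ 2) ^ 3 / 7))) =
      M * (N * (h ^ (2 * 1 + 2) / (2 * (1 : ℕ) + 2) *
        (t + t ^ 3 / 3 - (-t + (-t) ^ 3 / 3))) - 2 * (7 / 25 / h ^ 2) *
        (N * (h ^ (2 * 2 + 2) / (2 * (2 : ℕ) + 2) * (t + 2 * t ^ 3 / 3 + t ^ 5 / 5 -
        (-t + 2 * (-t) ^ 3 / 3 + (-t) ^ 5 / 5)))) + (7 / 25 / h ^ 2) ^ 2 *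
        (N * (h ^ (2 * 3 + 2) / (2 * (3 : ℕ) + 2) * (t + t ^ 3 + 3 * t ^ 5 / 5 + t ^ 7 / 7 -
        (-t + (-t) ^ 3 + 3 * (-t) ^ 5 / 5 + (-t) ^ 7 / 7))))) := by
  have e1 : 7 / 25 / h ^ 2 * h ^ 6 = 7 / 25 * h ^ 4 := by field_simp
  have e2 : (7 / 25 / h ^ 2) ^ 2 * h ^ 8 = (7 / 25) ^ 2 * h ^ 4 := by field_simp
  push_cast
  linear_combination (M * N * 2 / 6 * 2 * (t + 2 * t ^ 3 / 3 + t ^ 5 / 5)) * e1 -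
    (M * N * 2 / 8 * (t + t ^ 3 + 3 * t ^ 5 / 5 + t ^ 7 / 7)) * e2

theorem moment_combination_right (N h t : ℝ) (hh : h ≠ 0) :
    N * t * h ^ 2 * (2 - 28 / 25 * (1 + t ^ 2 / 3) +
      196 / 750 * (1 + 2 * t ^ 2 / 3 + (t ^ 2) ^ 2 / 5)) =
      2 * (N * (h ^ (2 * 0 + 2) / (2 * (0 : ℕ) + 2) * (t - -t))) -
        8 * (7 / 25 / h ^ 2) * (N * (h ^ (2 * 1 + 2) / (2 * (1 : ℕ) + 2) *
        (t + t ^ 3 / 3 - (-t + (-t) ^ 3 / 3)))) + 10 * (7 / 25 / h ^ 2) ^ 2 *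
        (N * (h ^ (2 * 2 + 2) / (2 * (2 : ℕ) + 2) * (t + 2 * t ^ 3 / 3 + t ^ 5 / 5 -
        (-t + 2 * (-t) ^ 3 / 3 + (-t) ^ 5 / 5)))) := by
  have e1 : 7 / 25 / h ^ 2 * h ^ 4 = 7 / 25 * h ^ 2 := by field_simp
  have e2 : (7 / 25 / h ^ 2) ^ 2 * h ^ 6 = (7 / 25) ^ 2 * h ^ 2 := by field_simp
  push_cast
  linear_combination (8 * N * 2 / 4 * (t + t ^ 3 / 3)) * e1 -
    (10 * N * 2 / 6 * (t + 2 * t ^ 3 / 3 + t ^ 5 / 5)) * e2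

/-! ### The trial function for at least five sides -/

section TrialFunction

variable {N : ℕ} {c : Plane} {r α : ℝ}

/-- Rotation by `2π/N` about the centre preserves the polygon and the radial weight, so it fixes the
integral; only the zero vector is fixed. -/
theorem integral_radial_smul_eq_zero (hN : 3 ≤ N) (g : ℝ → ℝ) :
    ∫ x in regPolygon N c r α, g (‖x - c‖ ^ 2) • (x - c) = 0 := by
  have hN0 : 0 < N := by omega
  have hN' : (0 : ℝ) < N := by positivity
  have hN3 : (3 : ℝ) ≤ N := by exact_mod_cast hN
  have hpi := Real.pi_pos
  set w : ℝ := 2 * Real.pi / N with hw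
  set ρ : Plane ≃ₗᵢ[ℝ] Plane := Complex.orthonormalBasisOneI.repr.symm.trans
    ((rotation (Circle.exp w)).trans Complex.orthonormalBasisOneI.repr) with hρ
  have hdir : ∀ θ : ℝ, Complex.orthonormalBasisOneI.repr (Complex.exp (θ * Complex.I)) = dir θ := by
    intro θ
    have := repr_polarCoord_symm (1, θ)
    rw [Complex.polarCoord_symm_apply, one_smul] at this
    rw [← this, Complex.exp_mul_I]
    simp
  have hρdir : ∀ θ, ρ (dir θ) = dir (θ + w) := by
    intro θ
    rw [hρ, ← hdir, ← hdir]
    simp only [LinearIsometryEquiv.trans_apply, LinearIsometryEquiv.symm_apply_apply,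
      rotation_apply, Circle.coe_exp]
    rw [← Complex.exp_add]
    push_cast
    congr 2
    ring
  have hmem : ∀ y, c + ρ y ∈ regPolygon N c r α ↔ c + y ∈ regPolygon N c r α := by
    intro y
    obtain ⟨s, φ, -, rfl⟩ := exists_eq_smul_dir y
    rw [map_smul, hρdir]
    exact mem_regPolygon_polar_periodic hN0 s φ
  have hm : MeasurableSet (regPolygon N c r α) := (isOpen_openPolygon _ _).measurableSet
  set I := ∫ x in regPolygon N c r α, g (‖x - c‖ ^ 2) • (x - c) with hI
  have hI2 : I = ∫ y, (regPolygon N c r α).indicator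
      (fun x => g (‖x - c‖ ^ 2) • (x - c)) (c + y) := by
    rw [integral_add_left_eq_self (fun y => (regPolygon N c r α).indicator
      (fun x => g (‖x - c‖ ^ 2) • (x - c)) y) c, integral_indicator hm]
  have hfix : ρ I = I := by
    conv_rhs => rw [hI2]
    rw [← ρ.measurePreserving.integral_comp ρ.toHomeomorph.measurableEmbedding, hI2]
    refine (ContinuousLinearEquiv.integral_comp_comm ρ.toContinuousLinearEquiv _).symm.trans ?_
    refine integral_congr_ae (Filter.Eventually.of_forall fun y => ?_)
    by_cases hy : c + y ∈ regPolygon N c r α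
    · simp [Set.indicator_of_mem hy, Set.indicator_of_mem ((hmem y).2 hy)]
    · simp [Set.indicator_of_notMem hy, Set.indicator_of_notMem (mt (hmem y).1 hy)]
  obtain ⟨s, φ, hs, hIeq⟩ := exists_eq_smul_dir I
  rw [hIeq, map_smul, hρdir] at hfix
  have h1 := congrArg (fun z => inner ℝ (dir φ) z) hfix
  simp only [inner_smul_right, inner_dir, sub_self, Real.cos_zero] at h1
  have hcos : Real.cos (φ - (φ + w)) < 1 := by
    rw [show φ - (φ + w) = -w by ring, Real.cos_neg, ← Real.cos_zero]
    refine Real.cos_lt_cos_of_nonneg_of_le_pi le_rfl ?_ (by positivity)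
    rw [hw, div_le_iff₀ hN']; nlinarith
  have : s = 0 := by nlinarith
  rw [hIeq, this, zero_smul]

theorem isH1With_trial {Ω : Set Plane} (hb : Bornology.IsBounded Ω) (κ : ℝ) (c v : Plane) :
    IsH1With Ω (fun x => (1 - κ * ‖x - c‖ ^ 2) * inner ℝ (x - c) v)
      (fun x => (1 - κ * ‖x - c‖ ^ 2) • v - (2 * κ * inner ℝ (x - c) v) • (x - c)) := by
  have hy : ContDiff ℝ ∞ fun x : Plane => x - c := contDiff_id.sub contDiff_const
  refine isH1With_of_contDiff hb ?_ ?_ fun x z => ?_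
  · exact (contDiff_const.sub (contDiff_const.mul (hy.norm_sq ℝ))).mul (hy.inner ℝ contDiff_const)
  · fun_prop
  · have h1 : HasFDerivAt (fun x : Plane => x - c) (ContinuousLinearMap.id ℝ Plane) x :=
      (hasFDerivAt_id x).sub_const c
    have h2 := (h1.norm_sq.const_mul κ).const_sub 1
    have h3 := h1.inner ℝ (hasFDerivAt_const v x)
    have h4 := h2.fun_mul h3
    rw [h4.fderiv]
    simp only [inner_sub_left, real_inner_smul_left]
    simp
    rw [real_inner_comm v z]
    ring

/-- Adding the Rayleigh inequalities for two orthonormal directions `v` eliminates the angle through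
`⟨y, e₀⟩² + ⟨y, e₁⟩² = ‖y‖²`. -/
theorem neumannMu1_mul_moment_le (hN : 3 ≤ N) (hr : 0 < r) (κ : ℝ) :
    neumannMu1 (regPolygon N c r α) * ((∫ x in regPolygon N c r α, (‖x - c‖ ^ 2) ^ 1) -
      2 * κ * (∫ x in regPolygon N c r α, (‖x - c‖ ^ 2) ^ 2) +
      κ ^ 2 * ∫ x in regPolygon N c r α, (‖x - c‖ ^ 2) ^ 3) ≤
    2 * (∫ x in regPolygon N c r α, (‖x - c‖ ^ 2) ^ 0) -
      8 * κ * (∫ x in regPolygon N c r α, (‖x - c‖ ^ 2) ^ 1) +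
      10 * κ ^ 2 * ∫ x in regPolygon N c r α, (‖x - c‖ ^ 2) ^ 2 := by
  set Ω := regPolygon N c r α with hΩ
  have hb : Bornology.IsBounded Ω := isBounded_regPolygon hN hr
  have hint : ∀ {f : Plane → ℝ}, Continuous f → Integrable f (volume.restrict Ω) := fun hf =>
    integrable_restrict_of_continuous hb hf
  have hM : ∀ k : ℕ, Integrable (fun x => (‖x - c‖ ^ 2) ^ k) (volume.restrict Ω) := fun k =>
    hint (by fun_prop)
  have hmean : ∀ v : Plane, ∫ x in Ω, (1 - κ * ‖x - c‖ ^ 2) * inner ℝ (x - c) v = 0 := by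
    intro v
    have h1 := integral_radial_smul_eq_zero (c := c) (r := r) (α := α) hN fun s => 1 - κ * s
    have h2 : Integrable (fun x => (1 - κ * ‖x - c‖ ^ 2) • (x - c)) (volume.restrict Ω) :=
      integrable_restrict_of_continuous hb (by fun_prop)
    have h3 := integral_inner (𝕜 := ℝ) h2 v
    rw [h1, inner_zero_right] at h3
    rw [← h3]
    refine integral_congr_ae (Filter.Eventually.of_forall fun x => ?_)
    simp only [inner_smul_right, real_inner_comm]
  have hle : ∀ v : Plane, neumannMu1 Ω *
      (∫ x in Ω, ((1 - κ * ‖x - c‖ ^ 2) * inner ℝ (x - c) v) ^ 2) ≤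
      ∫ x in Ω, ‖(1 - κ * ‖x - c‖ ^ 2) • v - (2 * κ * inner ℝ (x - c) v) • (x - c)‖ ^ 2 :=
    fun v => neumannMu1_le (isH1With_trial hb κ c v) (hmean v)
  have hpyth : ∀ y : Plane, inner ℝ y (EuclideanSpace.single 0 1 : Plane) ^ 2 +
      inner ℝ y (EuclideanSpace.single 1 1 : Plane) ^ 2 = ‖y‖ ^ 2 := fun y => by
    rw [EuclideanSpace.real_norm_sq_eq]; simp [EuclideanSpace.inner_single_right]
  have hsum := add_le_add (hle (EuclideanSpace.single 0 1)) (hle (EuclideanSpace.single 1 1))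
  rw [← mul_add, ← integral_add (hint (by fun_prop)) (hint (by fun_prop)),
    ← integral_add (hint (by fun_prop)) (hint (by fun_prop))] at hsum
  have e1 : ∀ x, ((1 - κ * ‖x - c‖ ^ 2) * inner ℝ (x - c) (EuclideanSpace.single 0 1)) ^ 2 +
      ((1 - κ * ‖x - c‖ ^ 2) * inner ℝ (x - c) (EuclideanSpace.single 1 1)) ^ 2 =
      (‖x - c‖ ^ 2) ^ 1 - 2 * κ * (‖x - c‖ ^ 2) ^ 2 + κ ^ 2 * (‖x - c‖ ^ 2) ^ 3 := fun x => by
    linear_combination ((1 - κ * ‖x - c‖ ^ 2) ^ 2) * hpyth (x - c)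
  have hnorm : ∀ (v y : Plane), ‖v‖ = 1 →
      ‖(1 - κ * ‖y‖ ^ 2) • v - (2 * κ * inner ℝ y v) • y‖ ^ 2 =
      (1 - κ * ‖y‖ ^ 2) ^ 2 - 4 * κ * (1 - κ * ‖y‖ ^ 2) * inner ℝ y v ^ 2 +
        4 * κ ^ 2 * inner ℝ y v ^ 2 * ‖y‖ ^ 2 := by
    intro v y hv
    rw [norm_sub_sq_real, norm_smul, norm_smul, hv, real_inner_smul_left, inner_smul_right,
      mul_pow, mul_pow, Real.norm_eq_abs, Real.norm_eq_abs, sq_abs, sq_abs, real_inner_comm]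
    ring
  have e2 : ∀ x, ‖(1 - κ * ‖x - c‖ ^ 2) • (EuclideanSpace.single 0 1 : Plane) -
      (2 * κ * inner ℝ (x - c) (EuclideanSpace.single 0 1 : Plane)) • (x - c)‖ ^ 2 +
      ‖(1 - κ * ‖x - c‖ ^ 2) • (EuclideanSpace.single 1 1 : Plane) -
      (2 * κ * inner ℝ (x - c) (EuclideanSpace.single 1 1 : Plane)) • (x - c)‖ ^ 2 =
      2 * (‖x - c‖ ^ 2) ^ 0 - 8 * κ * (‖x - c‖ ^ 2) ^ 1 + 10 * κ ^ 2 * (‖x - c‖ ^ 2) ^ 2 :=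
    fun x => by
      rw [hnorm _ _ (by simp), hnorm _ _ (by simp)]
      linear_combination (-4 * κ * (1 - κ * ‖x - c‖ ^ 2) + 4 * κ ^ 2 * ‖x - c‖ ^ 2) *
        hpyth (x - c)
  simp only [e1, e2] at hsum
  have i1 := (hM 1).sub ((hM 2).const_mul (2 * κ))
  have i2 := ((hM 0).const_mul 2).sub ((hM 1).const_mul (8 * κ))
  rw [integral_add (by exact i1) ((hM 3).const_mul _), integral_sub (hM 1) ((hM 2).const_mul _),
    integral_add (by exact i2) ((hM 2).const_mul _),
    integral_sub ((hM 0).const_mul _) ((hM 1).const_mul _), integral_const_mul, integral_const_mul,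
    integral_const_mul, integral_const_mul, integral_const_mul] at hsum
  exact hsum

theorem neumannMu1_regPolygon_le (hN : 5 ≤ N) (hr : 0 < r) :
    perimeter (regPolygon N c r α) ^ 2 * neumannMu1 (regPolygon N c r α) ≤ 16 * Real.pi ^ 2 := by
  have hN3 : 3 ≤ N := by omega
  have hN' : (0 : ℝ) < N := by positivity
  have hN5 : (5 : ℝ) ≤ N := by exact_mod_cast hN
  have hpi := Real.pi_pos
  have hx0 : 0 < Real.pi / N := by positivity
  have hx2 : Real.pi / N < Real.pi / 2 := by
    rw [div_lt_div_iff₀ hN' two_pos]; nlinarith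
  have hh := inradius_pos hN3 hr
  set h := r * Real.cos (Real.pi / N) with hh_def
  set t := Real.tan (Real.pi / N) with ht_def
  have ht : 0 < t := Real.tan_pos_of_pos_of_lt_pi_div_two hx0 hx2
  have hw := tan_sq_pi_div_le hN
  have hcos : 0 < Real.cos (Real.pi / N) := Real.cos_pos_of_mem_Ioo ⟨by linarith, hx2⟩
  have hper : perimeter (regPolygon N c r α) = 2 * N * h * t := by
    rw [perimeter_regPolygon hN3 hr, hh_def, ht_def, Real.tan_eq_sin_div_cos]
    field_simp
  have harc : t - t ^ 3 / 3 + t ^ 5 / 5 - t ^ 7 / 7 ≤ Real.pi / N := by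
    have := le_arctan_of_nonneg ht.le
    rwa [ht_def, Real.arctan_tan (by linarith) hx2] at this
  have m0 := moment_regPolygon (c := c) (α := α) hN3 hr 0 (Q := fun s => s) fun s => by
    simpa using hasDerivAt_id' s
  have m1 := moment_regPolygon (c := c) (α := α) hN3 hr 1 (Q := fun s => s + s ^ 3 / 3) fun s => by
    refine ((hasDerivAt_id' s).add ((hasDerivAt_pow 3 s).div_const 3)).congr_deriv ?_
    norm_num
  have m2 := moment_regPolygon (c := c) (α := α) hN3 hr 2
    (Q := fun s => s + 2 * s ^ 3 / 3 + s ^ 5 / 5) fun s => by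
    refine (((hasDerivAt_id' s).add (((hasDerivAt_pow 3 s).const_mul 2).div_const 3)).add
      ((hasDerivAt_pow 5 s).div_const 5)).congr_deriv ?_
    norm_num
    ring
  have m3 := moment_regPolygon (c := c) (α := α) hN3 hr 3
    (Q := fun s => s + s ^ 3 + 3 * s ^ 5 / 5 + s ^ 7 / 7) fun s => by
    refine ((((hasDerivAt_id' s).add (hasDerivAt_pow 3 s)).add
      (((hasDerivAt_pow 5 s).const_mul 3).div_const 5)).add
      ((hasDerivAt_pow 7 s).div_const 7)).congr_deriv ?_
    norm_num
    ring
  -- The profile `ρ (1 - κρ²)` imitates the Bessel function of the disc: for this `κ` its derivative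
  -- vanishes at `ρ = h √(25/21)`, slightly outside the inscribed circle.
  have hmain := neumannMu1_mul_moment_le (c := c) (α := α) hN3 hr (7 / 25 / h ^ 2)
  rw [m0, m1, m2, m3, ← hh_def, ← ht_def] at hmain
  set M := neumannMu1 (regPolygon N c r α) with hM
  set w := t ^ 2 with hw_def
  set D := (1 + w / 3) / 2 - 14 / 75 * (1 + 2 * w / 3 + w ^ 2 / 5) +
          49 / 2500 * (1 + w + 3 * w ^ 2 / 5 + w ^ 3 / 7) with hD
  set E := 2 - 28 / 25 * (1 + w / 3) + 196 / 750 * (1 + 2 * w / 3 + w ^ 2 / 5) with hE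
  have hw0 : 0 < w := by positivity
  have hw1 : w ≤ 1 := by linarith
  have hw2 : w ^ 2 ≤ 1 := pow_le_one₀ hw0.le hw1
  have hw2' : 0 ≤ w ^ 2 := by positivity
  have hw3 : w ^ 3 ≤ 1 := pow_le_one₀ hw0.le hw1
  have hw3' : 0 ≤ w ^ 3 := by positivity
  have hDpos : 0 < D := by
    rw [hD]
    linarith
  have hMle : M * h ^ 2 * D ≤ E := by
    have hk : 0 < N * t * h ^ 2 := by positivity
    refine le_of_mul_le_mul_left ?_ hk
    have l := moment_combination_left N h t M hh.ne'
    have l2 := moment_combination_right N h t hh.ne'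
    rw [hD, hE, hw_def, l, l2]
    exact hmain
  have hpoly := five_le_polynomial_bound hw0.le hw
  rw [← hD, ← hE] at hpoly
  have hMh : M * h ^ 2 ≤ 4 * (1 - w / 3 + w ^ 2 / 5 - w ^ 3 / 7) ^ 2 :=
    le_of_mul_le_mul_right (hMle.trans hpoly) hDpos
  have hL : 0 ≤ 1 - w / 3 + w ^ 2 / 5 - w ^ 3 / 7 := by
    linarith
  have harc2 : t * (1 - w / 3 + w ^ 2 / 5 - w ^ 3 / 7) ≤ Real.pi / N := by
    refine le_trans (le_of_eq ?_) harc
    rw [hw_def]; ring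
  have hNt : N * (t * (1 - w / 3 + w ^ 2 / 5 - w ^ 3 / 7)) ≤ Real.pi := by
    rwa [mul_comm, ← le_div_iff₀ hN']
  rw [hper]
  -- The Taylor factor in the bound for `M h²` is the one for which `t` times it is at most `arctan
  -- t = π/N`, so `N` cancels.
  calc (2 * N * h * t) ^ 2 * M = 4 * N ^ 2 * t ^ 2 * (M * h ^ 2) := by ring
    _ ≤ 4 * N ^ 2 * t ^ 2 * (4 * (1 - w / 3 + w ^ 2 / 5 - w ^ 3 / 7) ^ 2) := by gcongr
    _ = 16 * (N * (t * (1 - w / 3 + w ^ 2 / 5 - w ^ 3 / 7))) ^ 2 := by ring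
    _ ≤ 16 * Real.pi ^ 2 := by gcongr

end TrialFunction


/-! ### The cases of three and four sides, and the conclusion -/

/-- Two nonparallel directions span the plane; the addition formula for `sin (a - b)` combines the
two equations into one. -/
theorem eq_zero_of_inner_dir_eq_zero {a b : ℝ} (hab : Real.sin (a - b) ≠ 0) {z : Plane}
    (ha : inner ℝ (dir a) z = 0) (hb : inner ℝ (dir b) z = 0) : z = 0 := by
  obtain ⟨s, φ, -, rfl⟩ := exists_eq_smul_dir z
  rw [inner_smul_right, inner_dir] at ha hb
  have h : s * Real.sin (a - b) = 0 := by
    rw [show a - b = (a - φ) - (b - φ) by ring, Real.sin_sub]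
    linear_combination Real.sin (a - φ) * hb - Real.sin (b - φ) * ha
  rw [(mul_eq_zero.1 h).resolve_right hab, zero_smul]

theorem dir_add_pi (a : ℝ) : dir (a + Real.pi) = -dir a := by
  ext i
  fin_cases i <;> simp [dir]

variable {c : Plane} {r α : ℝ}

theorem neumannMu1_equilateral (hr : 0 < r) :
    neumannMu1 (regPolygon 3 c r α) = 4 * Real.pi ^ 2 / (27 * (r / 2) ^ 2) := by
  have hinner : ∀ i j : Fin 3, i ≠ j →
      inner ℝ (outerNormal 3 α (i : ℕ)) (outerNormal 3 α (j : ℕ)) = -1 / 2 := by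
    have h1 : Real.cos (2 * Real.pi / 3) = -1 / 2 := by
      rw [show 2 * Real.pi / 3 = Real.pi - Real.pi / 3 by ring, Real.cos_pi_sub,
        Real.cos_pi_div_three]
      norm_num
    have h2 : Real.cos (4 * Real.pi / 3) = -1 / 2 := by
      rw [show 4 * Real.pi / 3 = Real.pi / 3 + Real.pi by ring, Real.cos_add_pi,
        Real.cos_pi_div_three]
      norm_num
    have e : ∀ i j : ℤ, inner ℝ (outerNormal 3 α i) (outerNormal 3 α j) =
        Real.cos (|(i - j : ℝ)| * (2 * Real.pi / 3)) := by
      intro i j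
      rw [outerNormal, outerNormal, inner_dir, ← Real.cos_abs, Nat.cast_ofNat,
        show α + (2 * (i : ℝ) + 1) * Real.pi / 3 - (α + (2 * (j : ℝ) + 1) * Real.pi / 3) =
          (i - j) * (2 * Real.pi / 3) by ring, abs_mul,
        abs_of_pos (by positivity : 0 < 2 * Real.pi / 3)]
    have h2' : Real.cos (2 * (2 * Real.pi / 3)) = -1 / 2 := by
      rw [← h2]; congr 1; ring
    intro i j hij
    rw [e]
    fin_cases i <;> fin_cases j <;> first | exact absurd rfl hij | skip
    all_goals norm_num
    all_goals first | exact h1.trans (by norm_num) | exact h2'.trans (by norm_num)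
  have hh : r * Real.cos (Real.pi / (3 : ℕ)) = r / 2 := by
    rw [Nat.cast_ofNat, Real.cos_pi_div_three]; ring
  have hb := isBounded_regPolygon (c := c) (α := α) (N := 3) le_rfl hr
  rw [regPolygon] at hb ⊢
  refine neumannMu1_triangle hb (by positivity) (fun k => norm_outerNormal _ _ _) hinner ?_ c
    (fun k => by rw [hh]) fun z hz0 hz1 => ?_
  -- The squared norm of the sum of the normals is `3 + 6 · (-1/2) = 0`.
  · rw [← norm_eq_zero, ← sq_eq_zero_iff, norm_add_sq_real, norm_add_sq_real, inner_add_left,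
      hinner 0 1 (by decide), hinner 0 2 (by decide), hinner 1 2 (by decide)]
    simp only [norm_outerNormal]
    norm_num
  · refine eq_zero_of_inner_dir_eq_zero ?_ hz1 hz0
    rw [show α + (2 * (((1 : Fin 3) : ℕ) : ℤ) + 1 : ℝ) * Real.pi / (3 : ℕ) -
      (α + (2 * (((0 : Fin 3) : ℕ) : ℤ) + 1 : ℝ) * Real.pi / (3 : ℕ)) =
      Real.pi - Real.pi / 3 by push_cast; norm_num, Real.sin_pi_sub]
    exact (Real.sin_pos_of_pos_of_lt_pi (by positivity) (by linarith [Real.pi_pos])).ne'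

theorem neumannMu1_regSquare (hr : 0 < r) :
    neumannMu1 (regPolygon 4 c r α) =
      Real.pi ^ 2 / (4 * (r * Real.cos (Real.pi / 4)) ^ 2) := by
  have hb := isBounded_regPolygon (c := c) (α := α) (N := 4) (by norm_num) hr
  have hh := inradius_pos (N := 4) (by norm_num) hr
  have hdiff : α + (2 * (((1 : Fin 4) : ℕ) : ℤ) + 1 : ℝ) * Real.pi / (4 : ℕ) -
      (α + (2 * (((0 : Fin 4) : ℕ) : ℤ) + 1 : ℝ) * Real.pi / (4 : ℕ)) = Real.pi / 2 := by
    push_cast; norm_num; ring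
  rw [regPolygon] at hb ⊢
  rw [Nat.cast_ofNat] at hh hb ⊢
  refine neumannMu1_square hb hh (fun k => norm_outerNormal _ _ _) ?_ ?_ ?_ c
    (fun k => rfl) fun z hz0 hz1 => ?_
  · rw [real_inner_comm, outerNormal, outerNormal, inner_dir, hdiff, Real.cos_pi_div_two]
  · rw [outerNormal, outerNormal, ← dir_add_pi]
    congr 1
    push_cast; norm_num; ring
  · rw [outerNormal, outerNormal, ← dir_add_pi]
    congr 1
    push_cast; norm_num; ring
  · refine eq_zero_of_inner_dir_eq_zero ?_ hz1 hz0
    rw [hdiff, Real.sin_pi_div_two]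
    exact one_ne_zero

end NeumannPolygon

theorem mainTheorem11 (N : ℕ) (Ω : Set NeumannPolygon.Plane)
    (hΩ : NeumannPolygon.IsRegularPolygon N Ω) :
    NeumannPolygon.perimeter Ω ^ 2 * NeumannPolygon.neumannMu1 Ω ≤ 16 * Real.pi ^ 2 ∧
      (N = 3 ∨ N = 4 →
        NeumannPolygon.perimeter Ω ^ 2 * NeumannPolygon.neumannMu1 Ω = 16 * Real.pi ^ 2) := by
  obtain ⟨hN, c, r, α, hr, rfl⟩ := hΩ
  rw [NeumannPolygon.interior_hull hN hr]
  have heq : N = 3 ∨ N = 4 → NeumannPolygon.perimeter (NeumannPolygon.regPolygon N c r α) ^ 2 *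
      NeumannPolygon.neumannMu1 (NeumannPolygon.regPolygon N c r α) = 16 * Real.pi ^ 2 := by
    rintro (rfl | rfl)
    -- Here `P² = 27r²` and `μ₁ = 16π²/(27r²)`; for the square, `P² = 32r²` and `μ₁ = π²/(2r²)`.
    · rw [NeumannPolygon.perimeter_regPolygon hN hr, NeumannPolygon.neumannMu1_equilateral hr,
        Nat.cast_ofNat, mul_pow, Real.sq_sin_pi_div_three]
      field_simp
      norm_num
    · rw [NeumannPolygon.perimeter_regPolygon hN hr, NeumannPolygon.neumannMu1_regSquare hr,
        Nat.cast_ofNat, Real.sin_pi_div_four, Real.cos_pi_div_four]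
      field_simp
      norm_num
  refine ⟨?_, heq⟩
  rcases (by omega : (N = 3 ∨ N = 4) ∨ 5 ≤ N) with h | h
  · exact (heq h).le
  · exact NeumannPolygon.neumannMu1_regPolygon_le h hr
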